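/- \textbf{Setting.} There are $N\ge 2$ buyers with unit demand whose values $X_1,\dots,X_N$ are drawn independently from a distribution $F$ with support $[\underline x,\bar x]$, $0\le\underline x<\bar x$, and with a density $f$ that is continuous on $[\underline x,\bar x]$ and positive on $(\underline x,\bar x)$. The virtual value $\psi(x)=x-\frac{1-F(x)}{f(x)}$ is assumed to be strictly increasing on $(\underline x,\bar x)$ and to have a zero $\psi^{-1}(0)\in[\underline x,\bar x)$ (with $f(\psi^{-1}(0))>0$). For a profile $\mathbf x$ let $x_{(1)}\ge x_{(2)}\ge\dots$ be its entries in decreasing order (if $N=2$, put $x_{(3)}=0$). Two sellers, each with one unit of the same good, sell in sequence. The second seller uses a second-price auction with reserve price $r$, in which every buyer who did not obtain the first unit bids his value. The first seller chooses a direct mechanism $(P,t)$: given the reports $\mathbf x\in[\underline x,\bar x]^N$, buyer $i$ gets the first unit with probability $P_i(\mathbf x)\ge 0$, where $\sum_i P_i(\mathbf x)\le 1$, and makes the expected payment $t_i(\mathbf x)$. The functions $P_i,t_i$ are measurable and, for each report of buyer $i$, his payment is integrable over the others' values. A buyer of value $v$ gets gross payoff $v$ if he obtains the first unit, and $\max\{v-\max\{r,y\},0\}$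 otherwise, where $y$ is the highest value among the rivals who take part in the second auction (the term $y$ is dropped if there are none). The mechanism is incentive compatible if, when the others report truthfully, truthful reporting maximizes the interim expected payoff of every type $v\in[\underline x,\bar x]$ of every buyer; it is individually rational if every type of every buyer gets at least the expected payoff that he would have in the second auction if the first unit were allocated to nobody. It is optimal if it is incentive compatible and individually rational and if its expected revenue $\sum_i E[t_i(\mathbf X)]$ (computed as the expectation of the buyers' interim expected payments) is the largest among all incentive compatible and individually rational direct mechanisms, symmetric or not. \textbf{Theorem.} Let $r\in[\psi^{-1}(0),\bar x)$. Then the following direct mechanism is optimal for the first seller (ties are broken uniformly at random). 1. Allocation rule: the good is allocated if and only if $\psi(x_{(1)})\ge 0$. In that case it goes to the bidder with the highest value if $x_{(2)}<r$; if $x_{(2)}\ge r$, it goes to either the bidder with the highest or the bidder with the second-highest value, where the choice between these two may be made by any rule, that is, in favour of the highest bidder with probability $w(\mathbf x)$ for an arbitrary measurable $w:[\underline x,\bar x]^N\to[0,1]$. 2. Transfers: (a) if $\psi(x_{(1)})\ge 0$ and $x_{(2)}<r$, the bidder with the highest value pays $\max\{\psi^{-1}(0),x_{(2)}\}$ and the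 others pay nothing; (b) if $x_{(2)}\ge r$, the bidder who receives the good pays $\max\{r,x_{(3)}\}$ and the others pay nothing; (c) if the good is not allocated, nobody pays. -/

import Mathlib

open MeasureTheory

noncomputable section

namespace SequentialAuction

/-- The virtual valuation `ψ(x) = x - (1 - F(x)) / f(x)` of a value distribution `μ` with
distribution function `F` and density `f`. -/
def virtualValue (μ : Measure ℝ) (f : ℝ → ℝ) (x : ℝ) : ℝ :=
  x - (1 - ProbabilityTheory.cdf μ x) / f x

/-- The `k`-th highest entry `x₍ₖ₎` of the profile `x` (`k = 1, …, N`, counted with multiplicity):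
the largest `v` such that at least `k` entries are `≥ v`.  If there are fewer than `k` bidders the
set is empty and the value is `0`. -/
def orderStat {N : ℕ} (k : ℕ) (x : Fin N → ℝ) : ℝ :=
  sSup {v : ℝ | k ≤ (Finset.univ.filter fun i => v ≤ x i).card}

/-- The surplus, in a second-price auction with reserve price `r` and truthful bidding, of a buyer
of value `v` who competes with the set `S` of rivals, whose values are given by `x`:
`max {v - max {r, max_{k ∈ S} x_k}, 0}`. -/
def secondPriceSurplus {N : ℕ} (r v : ℝ) (S : Finset (Fin N)) (x : Fin N → ℝ) : ℝ :=
  max (v - S.fold max r x) 0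

/-- A direct mechanism of the first seller: for a profile `x` of reports, `alloc x i` is the
probability that buyer `i` gets the first good and `pay x i` is buyer `i`'s (expected) payment. -/
structure DirectMechanism (N : ℕ) where
  alloc : (Fin N → ℝ) → Fin N → ℝ
  pay : (Fin N → ℝ) → Fin N → ℝ

/-- Payoff of buyer `i` with true value `v`, gross of the payment to the first seller, when the
reports are `x` and the rivals' reports are their true values.  If `i` gets the first good he gets
`v`; if rival `j` gets it, `i` meets all rivals but `j` in the second auction; if nobody gets it,
`i` meets all rivals there. -/
def grossPayoff {N : ℕ} (r : ℝ) (P : (Fin N → ℝ) → Fin N → ℝ) (i : Fin N) (v : ℝ)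
    (x : Fin N → ℝ) : ℝ :=
  P x i * v
    + ∑ j ∈ Finset.univ.erase i,
        P x j * secondPriceSurplus r v ((Finset.univ.erase i).erase j) x
    + (1 - ∑ j, P x j) * secondPriceSurplus r v (Finset.univ.erase i) x

/-- Expectation of `g` at the report profile in which buyer `i` reports `q` and the reports of the
others are independent draws from `μ`. -/
def interim {N : ℕ} (μ : Measure ℝ) (i : Fin N) (q : ℝ) (g : (Fin N → ℝ) → ℝ) : ℝ :=
  ∫ x, g (Function.update x i q) ∂(Measure.pi fun _ : Fin N => μ)

/-- `Π_i(q | v)`: expected gross payoff of buyer `i` of value `v` who reports `q`. -/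
def interimGross {N : ℕ} (μ : Measure ℝ) (r : ℝ) (M : DirectMechanism N) (i : Fin N)
    (q v : ℝ) : ℝ :=
  interim μ i q (grossPayoff r M.alloc i v)

/-- `t_i(q)`: expected payment of buyer `i` when he reports `q`. -/
def interimPay {N : ℕ} (μ : Measure ℝ) (M : DirectMechanism N) (i : Fin N) (q : ℝ) : ℝ :=
  interim μ i q fun x => M.pay x i

/-- Expected payoff of buyer `i` of value `v` if the first good is allocated to nobody. -/
def outsideOption {N : ℕ} (μ : Measure ℝ) (r : ℝ) (i : Fin N) (v : ℝ) : ℝ :=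
  interim μ i v (secondPriceSurplus r v (Finset.univ.erase i))

/-- Well-formed direct mechanisms on the type space `[lo, hi]^N`: allocation probabilities are
nonnegative and sum to at most one, and the expected payment of each report is well defined. -/
structure IsMechanism {N : ℕ} (μ : Measure ℝ) (lo hi : ℝ) (M : DirectMechanism N) : Prop where
  measurable_alloc : ∀ i, Measurable fun x => M.alloc x i
  measurable_pay : ∀ i, Measurable fun x => M.pay x i
  alloc_nonneg : ∀ x, (∀ j, x j ∈ Set.Icc lo hi) → ∀ i, 0 ≤ M.alloc x i
  sum_alloc_le : ∀ x, (∀ j, x j ∈ Set.Icc lo hi) → ∑ i, M.alloc x i ≤ 1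
  integrable_pay : ∀ i, ∀ q ∈ Set.Icc lo hi,
    Integrable (fun x => M.pay (Function.update x i q) i) (Measure.pi fun _ : Fin N => μ)

/-- (Bayesian) incentive compatibility: truthful reporting is a best response for every type. -/
def IncentiveCompatible {N : ℕ} (μ : Measure ℝ) (lo hi r : ℝ) (M : DirectMechanism N) : Prop :=
  ∀ i, ∀ v ∈ Set.Icc lo hi, ∀ q ∈ Set.Icc lo hi,
    interimGross μ r M i q v - interimPay μ M i q ≤
      interimGross μ r M i v v - interimPay μ M i v

/-- Individual rationality: every type gets at least his payoff from the second auction when the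
first good is allocated to nobody. -/
def IndividuallyRational {N : ℕ} (μ : Measure ℝ) (lo hi r : ℝ) (M : DirectMechanism N) : Prop :=
  ∀ i, ∀ v ∈ Set.Icc lo hi,
    outsideOption μ r i v ≤ interimGross μ r M i v v - interimPay μ M i v

/-- Well-formed, incentive compatible and individually rational direct mechanisms. -/
structure IsFeasible {N : ℕ} (μ : Measure ℝ) (lo hi r : ℝ) (M : DirectMechanism N) : Prop where
  isMechanism : IsMechanism μ lo hi M
  incentiveCompatible : IncentiveCompatible μ lo hi r M
  individuallyRational : IndividuallyRational μ lo hi r M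

/-- Expected revenue of the first seller under truthful reporting, `∑ᵢ E[t_i(X_i)]`. -/
def revenue {N : ℕ} (μ : Measure ℝ) (M : DirectMechanism N) : ℝ :=
  ∑ i, ∫ q, interimPay μ M i q ∂μ

/-- An optimal mechanism: feasible, with the largest expected revenue among all feasible ones. -/
def IsOptimal {N : ℕ} (μ : Measure ℝ) (lo hi r : ℝ) (M : DirectMechanism N) : Prop :=
  IsFeasible μ lo hi r M ∧ ∀ M' : DirectMechanism N, IsFeasible μ lo hi r M' →
    revenue μ M' ≤ revenue μ M

/-- Probability that buyer `i` is selected as the bidder with the `k`-th highest report, ties being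
broken uniformly at random. -/
def rankShare {N : ℕ} (k : ℕ) (x : Fin N → ℝ) (i : Fin N) : ℝ :=
  if x i = orderStat k x then
    1 / ((Finset.univ.filter fun j => x j = orderStat k x).card : ℝ) else 0

open Classical in
/-- The allocation rule: no allocation if `ψ(x₍₁₎) < 0`; otherwise to the highest bidder if
`x₍₂₎ < r`, and to the highest bidder with probability `w x` and the second-highest bidder with
probability `1 - w x` if `x₍₂₎ ≥ r`. -/
def candidateAlloc {N : ℕ} (ψ : ℝ → ℝ) (r : ℝ) (w : (Fin N → ℝ) → ℝ)
    (x : Fin N → ℝ) (i : Fin N) : ℝ :=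
  if 0 ≤ ψ (orderStat 1 x) then
    if orderStat 2 x < r then rankShare 1 x i
    else w x * rankShare 1 x i + (1 - w x) * rankShare 2 x i
  else 0

open Classical in
/-- The mechanism with this allocation rule in which only the buyer who receives the good pays:
`max {z, x₍₂₎}` if `x₍₂₎ < r` and `max {r, x₍₃₎}` if `x₍₂₎ ≥ r`. -/
def candidate {N : ℕ} (ψ : ℝ → ℝ) (z r : ℝ) (w : (Fin N → ℝ) → ℝ) : DirectMechanism N where
  alloc := candidateAlloc ψ r w
  pay x i := candidateAlloc ψ r w x i *
    (if orderStat 2 x < r then max z (orderStat 2 x) else max r (orderStat 3 x))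

end SequentialAuction

end

/-! The argument is Myerson's, with the second auction built into the buyers' payoffs. With the
reports fixed, a buyer's gross payoff is convex in his value; at a truthful report `winProb`, the
probability of ending up with one of the two units, is a subgradient. Incentive compatibility makes
its interim average a subgradient of the equilibrium payoff, so the envelope theorem
(`sub_eq_integral_of_subgradient`) determines interim payments up to the rent of the lowest type.
After integration by parts (`integral_integral_lower`), revenue is the expected sum of virtual
surpluses minus these rents (`integral_interimPay`). Individual rationality makes the rents
nonnegative.

The sum of virtual surpluses is affine in the allocation probabilities, hence can be maximized
profile by profile (`sum_virtualSurplus_le_candidate`). If `ψ(x₍₁₎) < 0`, then `x₍₁₎ < z ≤ r`: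
nothing is sold in the second auction, and a first sale contributes at most zero. Otherwise serving
the highest bidder is best. If `x₍₂₎ ≥ r`, serving the second-highest is equally good: either way
the top two get the units and the second auction's price is `max {r, x₍₃₎}`. This is why `w` is
free.

The candidate is feasible ex post, off ties (`netPayoff_candidate`): no report yields more than
`truthfulPayoff`, which does not depend on the own report, and truth attains it. That payoff
dominates the outside option and vanishes for values up to `z`, so the lowest type has no rent. Ties
are null because values have a density. -/

noncomputable section

namespace SequentialAuction

variable {N : ℕ}

/-! ### Lotteries over the recipient of the first unit -/

/-- Value for buyer `i` of the lottery that gives the first good to `j` with probability `p j`,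
when getting the good is worth `A` and meeting the rivals `S` in the second auction `B S`. -/
def lottery (p : Fin N → ℝ) (i : Fin N) (A : ℝ) (B : Finset (Fin N) → ℝ) : ℝ :=
  p i * A + ∑ j ∈ Finset.univ.erase i, p j * B ((Finset.univ.erase i).erase j)
    + (1 - ∑ j, p j) * B (Finset.univ.erase i)

lemma grossPayoff_eq_lottery (r : ℝ) (P : (Fin N → ℝ) → Fin N → ℝ) (i : Fin N) (v : ℝ)
    (x : Fin N → ℝ) :
    grossPayoff r P i v x = lottery (P x) i v fun S => secondPriceSurplus r v S x := rfl

lemma lottery_eq_sum (p : Fin N → ℝ) (i : Fin N) (A : ℝ) (B : Finset (Fin N) → ℝ) :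
    lottery p i A B = ∑ j, p j * (if j = i then A else B ((Finset.univ.erase i).erase j))
      + (1 - ∑ j, p j) * B (Finset.univ.erase i) := by
  rw [lottery, ← Finset.add_sum_erase _ (fun j => p j * ite _ _ _) (Finset.mem_univ i), if_pos rfl]
  congr 2
  exact Finset.sum_congr rfl fun j hj => by rw [if_neg (Finset.ne_of_mem_erase hj)]

lemma lottery_pair {a b : Fin N} (α : ℝ) (i : Fin N) (A : ℝ) (B : Finset (Fin N) → ℝ) :
    lottery (fun j => α * (if j = a then 1 else 0) + (1 - α) * (if j = b then 1 else 0)) i A B =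
      α * (if a = i then A else B ((Finset.univ.erase i).erase a))
        + (1 - α) * (if b = i then A else B ((Finset.univ.erase i).erase b)) := by
  rw [lottery_eq_sum]
  simp only [add_mul, Finset.sum_add_distrib, mul_assoc, ← Finset.mul_sum, ite_mul, one_mul,
    zero_mul, Finset.sum_ite_eq', Finset.mem_univ, if_true]
  simp

lemma lottery_add (p : Fin N → ℝ) (i : Fin N) (A A' : ℝ) (B B' : Finset (Fin N) → ℝ) :
    lottery p i (A + A') (fun S => B S + B' S) = lottery p i A B + lottery p i A' B' := by
  simp only [lottery, mul_add, Finset.sum_add_distrib]; ring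

lemma lottery_const_mul (p : Fin N → ℝ) (i : Fin N) (c A : ℝ) (B : Finset (Fin N) → ℝ) :
    lottery p i (c * A) (fun S => c * B S) = c * lottery p i A B := by
  simp only [lottery, mul_add, Finset.mul_sum]
  congr 1
  · congr 1
    · ring
    · exact Finset.sum_congr rfl fun _ _ => by ring
  · ring

lemma lottery_const (p : Fin N → ℝ) (i : Fin N) (c : ℝ) : lottery p i c (fun _ => c) = c := by
  simp only [lottery]
  rw [← Finset.add_sum_erase _ p (Finset.mem_univ i), ← Finset.sum_mul]
  ring

lemma lottery_mono {p : Fin N → ℝ} (hp : ∀ j, 0 ≤ p j) (hp1 : ∑ j, p j ≤ 1) (i : Fin N)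
    {A A' : ℝ} {B B' : Finset (Fin N) → ℝ} (hA : A ≤ A') (hB : ∀ S, B S ≤ B' S) :
    lottery p i A B ≤ lottery p i A' B' := by
  unfold lottery
  refine add_le_add (add_le_add (mul_le_mul_of_nonneg_left hA (hp i))
    (Finset.sum_le_sum fun j _ => mul_le_mul_of_nonneg_left (hB _) (hp j)))
    (mul_le_mul_of_nonneg_left (hB _) (by linarith))

lemma abs_lottery_le {p : Fin N → ℝ} (hp : ∀ j, 0 ≤ p j) (hp1 : ∑ j, p j ≤ 1) (i : Fin N)
    {A C : ℝ} {B : Finset (Fin N) → ℝ} (hA : |A| ≤ C) (hB : ∀ S, |B S| ≤ C) :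
    |lottery p i A B| ≤ C := by
  rw [abs_le]
  constructor
  · calc -C = lottery p i (-C) (fun _ => -C) := (lottery_const p i _).symm
      _ ≤ _ := lottery_mono hp hp1 i (abs_le.1 hA).1 fun S => (abs_le.1 (hB S)).1
  · calc lottery p i A B ≤ lottery p i C (fun _ => C) :=
          lottery_mono hp hp1 i (abs_le.1 hA).2 fun S => (abs_le.1 (hB S)).2
      _ = C := lottery_const p i _

lemma measurable_lottery {p : (Fin N → ℝ) → Fin N → ℝ} (hp : ∀ j, Measurable fun x => p x j)
    (i : Fin N) {A : (Fin N → ℝ) → ℝ} (hA : Measurable A) {B : (Fin N → ℝ) → Finset (Fin N) → ℝ}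
    (hB : ∀ S, Measurable fun x => B x S) : Measurable fun x => lottery (p x) i (A x) (B x) := by
  unfold lottery
  refine (((hp i).mul hA).add ?_).add ?_
  · exact Finset.measurable_fun_sum _ fun j _ => (hp j).mul (hB _)
  · exact (measurable_const.sub (Finset.measurable_fun_sum _ fun j _ => hp j)).mul (hB _)

/-! ### Prices in the second auction -/

lemma measurable_fold_max (r : ℝ) (S : Finset (Fin N)) :
    Measurable fun x : Fin N → ℝ => S.fold max r x := by
  induction S using Finset.induction_on with
  | empty => simp
  | insert a S ha ih => simpa [Finset.fold_insert ha] using (measurable_pi_apply a).max ih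

lemma le_fold_max_base (r : ℝ) (S : Finset (Fin N)) (x : Fin N → ℝ) : r ≤ S.fold max r x :=
  Finset.le_fold_max _ |>.2 (Or.inl le_rfl)

lemma le_fold_max_of_mem (r : ℝ) {S : Finset (Fin N)} (x : Fin N → ℝ) {i : Fin N} (hi : i ∈ S) :
    x i ≤ S.fold max r x :=
  Finset.le_fold_max _ |>.2 (Or.inr ⟨i, hi, le_rfl⟩)

lemma fold_max_mono (r : ℝ) {S T : Finset (Fin N)} (h : S ⊆ T) (x : Fin N → ℝ) :
    S.fold max r x ≤ T.fold max r x :=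
  Finset.fold_max_le _ |>.2
    ⟨le_fold_max_base r T x, fun _ hi => le_fold_max_of_mem r x (h hi)⟩

lemma fold_max_eq (r : ℝ) {S : Finset (Fin N)} (x : Fin N → ℝ) {i : Fin N} (hi : i ∈ S)
    (h : ∀ j ∈ S, x j ≤ x i) : S.fold max r x = max r (x i) :=
  le_antisymm
    (Finset.fold_max_le _ |>.2 ⟨le_max_left _ _, fun j hj => (h j hj).trans (le_max_right _ _)⟩)
    (max_le (le_fold_max_base r S x) (le_fold_max_of_mem r x hi))

lemma fold_max_eq_base (r : ℝ) {S : Finset (Fin N)} (x : Fin N → ℝ)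
    (h : ∀ j ∈ S, x j ≤ r) : S.fold max r x = r :=
  le_antisymm (Finset.fold_max_le _ |>.2 ⟨le_rfl, h⟩) (le_fold_max_base r S x)

lemma fold_max_update (r : ℝ) {S : Finset (Fin N)} (x : Fin N → ℝ) {i : Fin N} (hi : i ∉ S)
    (q : ℝ) : S.fold max r (Function.update x i q) = S.fold max r x :=
  Finset.fold_congr fun _ hj => Function.update_of_ne (ne_of_mem_of_not_mem hj hi) _ _

/-! ### Order statistics and rank shares -/

lemma bddAbove_orderStat_set {k : ℕ} (hk : 1 ≤ k) (x : Fin N → ℝ) :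
    BddAbove {v : ℝ | k ≤ (Finset.univ.filter fun i => v ≤ x i).card} := by
  obtain ⟨C, hC⟩ := (Set.finite_range x).bddAbove
  refine ⟨C, fun v hv => ?_⟩
  obtain ⟨i, hi⟩ := Finset.card_pos.1 (hk.trans hv)
  exact (Finset.mem_filter.1 hi).2.trans (hC ⟨i, rfl⟩)

/-- The defining supremum is attained, since the set of thresholds is closed: it is a finite union,
over the `k`-sets of bidders, of intersections of half-lines. -/
lemma le_orderStat_iff {k : ℕ} (hk : 1 ≤ k) (hkN : k ≤ N) (x : Fin N → ℝ) (c : ℝ) :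
    c ≤ orderStat k x ↔ k ≤ (Finset.univ.filter fun i => c ≤ x i).card := by
  set S := {v : ℝ | k ≤ (Finset.univ.filter fun i => v ≤ x i).card} with hS
  have hne : S.Nonempty := by
    obtain ⟨C, hC⟩ := (Set.finite_range x).bddBelow
    refine ⟨C, ?_⟩
    have : (Finset.univ.filter fun i => C ≤ x i) = Finset.univ :=
      Finset.filter_true_of_mem fun i _ => hC ⟨i, rfl⟩
    simp [hS, this, hkN]
  have hcl : IsClosed S := by
    have : S = ⋃ T ∈ (Finset.powersetCard k Finset.univ : Finset (Finset (Fin N))),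
        ⋂ i ∈ T, Set.Iic (x i) := by
      ext v
      simp only [hS, Set.mem_ofPred_eq, Set.mem_iUnion, Set.mem_iInter, Set.mem_Iic,
        Finset.mem_powersetCard, exists_prop]
      constructor
      · intro h
        obtain ⟨T, hT, hc⟩ := Finset.exists_subset_card_eq h
        exact ⟨T, ⟨Finset.subset_univ _, hc⟩, fun i hi => (Finset.mem_filter.1 (hT hi)).2⟩
      · rintro ⟨T, ⟨-, hc⟩, h⟩
        rw [← hc]
        exact Finset.card_le_card fun i hi => by simpa using h i hi
    rw [this]
    exact (Finset.finite_toSet _).isClosed_biUnion fun T _ =>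
      isClosed_biInter fun i _ => isClosed_Iic
  constructor
  · intro h
    have hm : k ≤ (Finset.univ.filter fun i => orderStat k x ≤ x i).card :=
      hcl.csSup_mem hne (bddAbove_orderStat_set hk x)
    refine hm.trans (Finset.card_le_card fun i hi => ?_)
    simp only [Finset.mem_filter, Finset.mem_univ, true_and] at hi ⊢
    exact h.trans hi
  · exact fun h => le_csSup (bddAbove_orderStat_set hk x) h

lemma orderStat_of_lt {k : ℕ} (hk : N < k) (x : Fin N → ℝ) : orderStat k x = 0 := by
  have : {v : ℝ | k ≤ (Finset.univ.filter fun i => v ≤ x i).card} = ∅ := by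
    ext v
    simp only [Set.mem_ofPred_eq, Set.mem_empty_iff_false, iff_false, not_le]
    refine lt_of_le_of_lt (Finset.card_le_univ _) (by simpa using hk)
  rw [orderStat, this, Real.sSup_empty]

lemma measurable_orderStat {k : ℕ} (hk : 1 ≤ k) :
    Measurable fun x : Fin N → ℝ => orderStat k x := by
  rcases lt_or_ge N k with h | h
  · simp only [orderStat_of_lt h, measurable_const]
  refine measurable_of_Ici fun c => ?_
  have : (fun x : Fin N → ℝ => orderStat k x) ⁻¹' Set.Ici c =
      {x | (k : ℝ) ≤ ∑ i, if c ≤ x i then (1 : ℝ) else 0} := by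
    ext x
    simp only [Set.mem_preimage, Set.mem_Ici, Set.mem_ofPred_eq, le_orderStat_iff hk h,
      Finset.sum_boole, Nat.cast_le]
  rw [this]
  refine measurableSet_le measurable_const (Finset.measurable_fun_sum _ fun i _ => ?_)
  exact Measurable.ite (measurableSet_le measurable_const (measurable_pi_apply i))
    measurable_const measurable_const

lemma orderStat_eq {k : ℕ} {x : Fin N → ℝ} {c : ℝ}
    (h1 : k ≤ (Finset.univ.filter fun i => c ≤ x i).card)
    (h2 : (Finset.univ.filter fun i => c < x i).card < k) : orderStat k x = c := by
  refine IsGreatest.csSup_eq ⟨h1, fun v hv => ?_⟩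
  by_contra! hcv
  refine (lt_of_lt_of_le h2 hv).not_ge (Finset.card_le_card fun i hi => ?_)
  simp only [Finset.mem_filter, Finset.mem_univ, true_and] at hi ⊢
  exact hcv.trans_le hi

lemma exists_eq_orderStat {k : ℕ} (hk : 1 ≤ k) (hkN : k ≤ N) (x : Fin N → ℝ) :
    ∃ i, x i = orderStat k x := by
  by_contra! hne
  have h := (le_orderStat_iff hk hkN x _).1 le_rfl
  set c := orderStat k x
  set T := Finset.univ.filter fun i => c ≤ x i
  have hT : T.Nonempty := Finset.card_pos.1 (hk.trans h)
  -- If no entry equals `c`, the smallest entry above `c` is still reached by `k` bidders, against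
  -- the maximality of `c`.
  obtain ⟨i, hi, hmin⟩ := Finset.exists_min_image T x hT
  have hi' : c < x i := lt_of_le_of_ne (Finset.mem_filter.1 hi).2 (hne i).symm
  refine hi'.not_ge ((le_orderStat_iff hk hkN x _).2 (h.trans (Finset.card_le_card ?_)))
  exact fun j hj => by simpa using hmin j hj

lemma rankShare_nonneg (k : ℕ) (x : Fin N → ℝ) (i : Fin N) : 0 ≤ rankShare k x i := by
  unfold rankShare; split_ifs <;> positivity

lemma sum_rankShare {k : ℕ} (hk : 1 ≤ k) (hkN : k ≤ N) (x : Fin N → ℝ) :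
    ∑ i, rankShare k x i = 1 := by
  unfold rankShare
  rw [← Finset.sum_filter, Finset.sum_const, nsmul_eq_mul]
  obtain ⟨i, hi⟩ := exists_eq_orderStat hk hkN x
  have : 0 < (Finset.univ.filter fun j => x j = orderStat k x).card :=
    Finset.card_pos.2 ⟨i, by simpa using hi⟩
  have : ((Finset.univ.filter fun j => x j = orderStat k x).card : ℝ) ≠ 0 := by positivity
  field_simp

lemma measurable_rankShare {k : ℕ} (hk : 1 ≤ k) (i : Fin N) :
    Measurable fun x : Fin N → ℝ => rankShare k x i := by
  have hs : ∀ j, MeasurableSet {x : Fin N → ℝ | x j = orderStat k x} := fun j =>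
    measurableSet_eq_fun (measurable_pi_apply j) (measurable_orderStat hk)
  unfold rankShare
  simp_rw [← Finset.sum_boole]
  refine Measurable.ite (hs i) (measurable_const.div ?_) measurable_const
  exact Finset.measurable_fun_sum _ fun j _ => Measurable.ite (hs j) measurable_const measurable_const

/-! ### Profiles with an untied top two -/

/-- `a` and `b` are the unique highest and the unique second-highest bidder. -/
structure IsTopTwo (x : Fin N → ℝ) (a b : Fin N) : Prop where
  lt : x b < x a
  lt_of_ne : ∀ i, i ≠ a → i ≠ b → x i < x b

namespace IsTopTwo

variable {x : Fin N → ℝ} {a b : Fin N}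

lemma ne (h : IsTopTwo x a b) : b ≠ a := fun e => (e ▸ h.lt).false

lemma le_snd (h : IsTopTwo x a b) {i : Fin N} (hi : i ≠ a) : x i ≤ x b := by
  rcases eq_or_ne i b with rfl | hb
  · exact le_rfl
  · exact (h.lt_of_ne i hi hb).le

lemma orderStat_one (h : IsTopTwo x a b) : orderStat 1 x = x a := by
  refine orderStat_eq (Finset.card_pos.2 ⟨a, by simp⟩) ?_
  rw [Nat.lt_one_iff, Finset.card_eq_zero, Finset.filter_eq_empty_iff]
  intro i _ hlt
  rcases eq_or_ne i a with rfl | ha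
  · exact hlt.false
  · exact ((h.le_snd ha).trans_lt h.lt).not_gt hlt

lemma orderStat_two (h : IsTopTwo x a b) : orderStat 2 x = x b := by
  refine orderStat_eq ?_ ?_
  · rw [← Finset.card_pair h.ne]
    refine Finset.card_le_card fun i hi => ?_
    simp only [Finset.mem_insert, Finset.mem_singleton] at hi
    rcases hi with rfl | rfl
    · simp
    · simpa using h.lt.le
  · refine lt_of_le_of_lt (Finset.card_le_card (t := {a}) fun i hi => ?_) (by simp)
    simp only [Finset.mem_filter, Finset.mem_univ, true_and, Finset.mem_singleton] at hi ⊢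
    by_contra ha
    exact (h.le_snd ha).not_gt hi

lemma max_orderStat_three (h : IsTopTwo x a b) {r : ℝ} (hr : 0 ≤ r) :
    max r (orderStat 3 x) = ((Finset.univ.erase a).erase b).fold max r x := by
  set S := (Finset.univ.erase a).erase b with hS
  have hcard : S.card + 2 = N := by
    have h1 := Finset.card_erase_add_one (Finset.mem_univ a)
    have h2 := Finset.card_erase_add_one (s := Finset.univ.erase a) (a := b) (by simp [h.ne])
    rw [Finset.card_univ, Fintype.card_fin] at h1
    rw [hS]
    omega
  rcases S.eq_empty_or_nonempty with he | hne
  -- Two bidders: the default value `0` of the third order statistic is absorbed by `r ≥ 0`.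
  · rw [he, Finset.fold_empty, orderStat_of_lt (by simp [he] at hcard; omega), max_eq_left hr]
  obtain ⟨d, hd, hmax⟩ := Finset.exists_max_image S x hne
  have hd' : d ≠ b ∧ d ≠ a := by simpa [hS] using hd
  rw [fold_max_eq r x hd hmax]
  congr 1
  refine orderStat_eq ?_ ?_
  · have h3 : ({a, b, d} : Finset (Fin N)).card = 3 :=
      Finset.card_eq_three.2 ⟨a, b, d, h.ne.symm, hd'.2.symm, hd'.1.symm, rfl⟩
    rw [← h3]
    refine Finset.card_le_card fun i hi => ?_
    have hdb := h.lt_of_ne d hd'.2 hd'.1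
    simp only [Finset.mem_insert, Finset.mem_singleton] at hi
    rcases hi with rfl | rfl | rfl
    · simpa using (hdb.trans h.lt).le
    · simpa using hdb.le
    · simp
  · refine lt_of_le_of_lt (Finset.card_le_card (t := {a, b}) fun i hi => ?_)
      (lt_of_le_of_lt Finset.card_le_two (by norm_num))
    simp only [Finset.mem_filter, Finset.mem_univ, true_and, Finset.mem_singleton,
      Finset.mem_insert] at hi ⊢
    by_contra! hab
    exact (hmax i (by simp [hS, hab])).not_gt hi

lemma rankShare_one (h : IsTopTwo x a b) (i : Fin N) :
    rankShare 1 x i = if i = a then 1 else 0 := by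
  have key : ∀ j, x j = x a ↔ j = a := fun j =>
    ⟨fun hj => by_contra fun ha => ((h.le_snd ha).trans_lt h.lt).ne hj, fun hj => by rw [hj]⟩
  simp [rankShare, h.orderStat_one, key, Finset.filter_eq']

lemma rankShare_two (h : IsTopTwo x a b) (i : Fin N) :
    rankShare 2 x i = if i = b then 1 else 0 := by
  have key : ∀ j, x j = x b ↔ j = b := by
    refine fun j => ⟨fun hj => by_contra fun hb => ?_, fun hj => by rw [hj]⟩
    rcases eq_or_ne j a with rfl | ha
    · exact h.lt.ne hj.symm
    · exact (h.lt_of_ne j ha hb).ne hj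
  simp [rankShare, h.orderStat_two, key, Finset.filter_eq']

end IsTopTwo

lemma exists_isTopTwo (hN : 2 ≤ N) {x : Fin N → ℝ} (hx : Function.Injective x) :
    ∃ a b, IsTopTwo x a b := by
  obtain ⟨a, -, ha⟩ := Finset.exists_max_image Finset.univ x ⟨⟨0, by omega⟩, Finset.mem_univ _⟩
  obtain ⟨b, hb, hmax⟩ := Finset.exists_max_image (Finset.univ.erase a) x (by
    rw [← Finset.card_pos, Finset.card_erase_of_mem (Finset.mem_univ _), Finset.card_univ,
      Fintype.card_fin]
    omega)
  have hba : b ≠ a := Finset.ne_of_mem_erase hb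
  refine ⟨a, b, lt_of_le_of_ne (ha b (Finset.mem_univ _)) (hx.ne hba), fun i hia hib => ?_⟩
  exact lt_of_le_of_ne (hmax i (by simp [hia])) (hx.ne hib)

lemma secondPriceSurplus_update (r v : ℝ) {S : Finset (Fin N)} (x : Fin N → ℝ) {i : Fin N}
    (hi : i ∉ S) (q : ℝ) :
    secondPriceSurplus r v S (Function.update x i q) = secondPriceSurplus r v S x := by
  rw [secondPriceSurplus, fold_max_update r x hi, secondPriceSurplus]

/-! ### Ex-post incentives in the candidate mechanism -/

section Candidate

variable {ψ : ℝ → ℝ} {z r : ℝ} {w : (Fin N → ℝ) → ℝ} {y : Fin N → ℝ} {a b : Fin N}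

/-- Payoff of buyer `i` of value `v` at the profile `y` of reports, net of his payment. -/
def netPayoff (r : ℝ) (M : DirectMechanism N) (i : Fin N) (v : ℝ) (y : Fin N → ℝ) : ℝ :=
  grossPayoff r M.alloc i v y - M.pay y i

lemma candidateAlloc_of_neg (h : IsTopTwo y a b) (hψ : ψ (y a) < 0) :
    candidateAlloc ψ r w y = fun _ => 0 := by
  funext i
  rw [candidateAlloc, h.orderStat_one, if_neg hψ.not_ge]

/-- The degenerate weight `1` gives the shape to which `lottery_pair` applies. -/
lemma candidateAlloc_of_lt (h : IsTopTwo y a b) (hψ : 0 ≤ ψ (y a)) (hb : y b < r) :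
    candidateAlloc ψ r w y =
      fun i => 1 * (if i = a then 1 else 0) + (1 - 1) * (if i = b then 1 else 0) := by
  funext i
  rw [candidateAlloc, h.orderStat_one, if_pos hψ, h.orderStat_two, if_pos hb, h.rankShare_one]
  ring

lemma candidateAlloc_of_le (h : IsTopTwo y a b) (hψ : 0 ≤ ψ (y a)) (hb : r ≤ y b) :
    candidateAlloc ψ r w y =
      fun i => w y * (if i = a then 1 else 0) + (1 - w y) * (if i = b then 1 else 0) := by
  funext i
  rw [candidateAlloc, h.orderStat_one, if_pos hψ, h.orderStat_two, if_neg hb.not_gt,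
    h.rankShare_one, h.rankShare_two]

lemma netPayoff_of_neg (h : IsTopTwo y a b) (hψ : ψ (y a) < 0) (i : Fin N) (v : ℝ) :
    netPayoff r (candidate ψ z r w) i v y =
      secondPriceSurplus r v (Finset.univ.erase i) y := by
  simp [netPayoff, candidate, grossPayoff_eq_lottery, candidateAlloc_of_neg h hψ, lottery_eq_sum]

lemma netPayoff_of_lt (h : IsTopTwo y a b) (hψ : 0 ≤ ψ (y a)) (hb : y b < r) (i : Fin N)
    (v : ℝ) :
    netPayoff r (candidate ψ z r w) i v y = if a = i then v - max z (y b)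
      else secondPriceSurplus r v ((Finset.univ.erase i).erase a) y := by
  simp only [netPayoff, candidate, grossPayoff_eq_lottery, candidateAlloc_of_lt h hψ hb,
    lottery_pair, h.orderStat_two, if_pos hb, @eq_comm _ i]
  split_ifs <;> ring

lemma netPayoff_of_le (h : IsTopTwo y a b) (hψ : 0 ≤ ψ (y a)) (hb : r ≤ y b) (hr : 0 ≤ r)
    (i : Fin N) (v : ℝ) :
    netPayoff r (candidate ψ z r w) i v y =
      w y * (if a = i then v - ((Finset.univ.erase a).erase b).fold max r y
        else secondPriceSurplus r v ((Finset.univ.erase i).erase a) y) +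
      (1 - w y) * (if b = i then v - ((Finset.univ.erase a).erase b).fold max r y
        else secondPriceSurplus r v ((Finset.univ.erase i).erase b) y) := by
  simp only [netPayoff, candidate, grossPayoff_eq_lottery, candidateAlloc_of_le h hψ hb,
    lottery_pair, h.orderStat_two, if_neg hb.not_gt, h.max_orderStat_three hr, @eq_comm _ i]
  split_ifs <;> ring

/-- Ex-post equilibrium payoff of buyer `i` of value `v` whose strongest rival is `c`. -/
def truthfulPayoff (z r : ℝ) (i c : Fin N) (v : ℝ) (y : Fin N → ℝ) : ℝ :=
  if y c < r then max (v - max z (y c)) 0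
    else secondPriceSurplus r v ((Finset.univ.erase i).erase c) y

lemma truthfulPayoff_update (z r : ℝ) {i c : Fin N} (hc : c ≠ i) (v q : ℝ) (x : Fin N → ℝ) :
    truthfulPayoff z r i c v (Function.update x i q) = truthfulPayoff z r i c v x := by
  rw [truthfulPayoff, Function.update_of_ne hc, secondPriceSurplus_update _ _ _ (by simp),
    truthfulPayoff]

/-- The source of individual rationality: the price behind the right-hand side is never above the
one met against all rivals, because `z ≤ r` in one case and a rival is missing in the other. -/
lemma secondPriceSurplus_le_truthfulPayoff (hz : z ≤ r) {i c : Fin N} (hc : c ≠ i) (v : ℝ)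
    (y : Fin N → ℝ) :
    secondPriceSurplus r v (Finset.univ.erase i) y ≤ truthfulPayoff z r i c v y := by
  unfold truthfulPayoff secondPriceSurplus
  have hle : max r (y c) ≤ (Finset.univ.erase i).fold max r y :=
    max_le (le_fold_max_base _ _ _) (le_fold_max_of_mem r y (by simp [hc]))
  split_ifs with h
  · exact max_le_max_right _ (sub_le_sub_left ((max_le_max_right _ hz).trans hle) _)
  · exact max_le_max_right _ (sub_le_sub_left (fold_max_mono r (Finset.erase_subset _ _) y) _)

lemma truthfulPayoff_eq_zero {i c : Fin N} {v : ℝ} (hvz : v ≤ z) (hz : z ≤ r) :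
    truthfulPayoff z r i c v y = 0 := by
  unfold truthfulPayoff secondPriceSurplus
  split_ifs with h
  · exact max_eq_right (sub_nonpos.2 (hvz.trans (le_max_left _ _)))
  · exact max_eq_right (sub_nonpos.2 ((hvz.trans hz).trans (le_fold_max_base _ _ _)))

/-- As in a second-price auction, the report affects whether a unit is obtained, but the prices on
offer are at least those in `truthfulPayoff`. The cases are: `i` reports highest, or `c` does with
`i` second or lower. -/
lemma netPayoff_candidate {lo hi : ℝ} (hN : 2 ≤ N)
    (hψ : ∀ t ∈ Set.Ioc lo hi, 0 ≤ ψ t ↔ z ≤ t) (hz0 : 0 ≤ z) (hzr : z ≤ r)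
    (hw : ∀ x, w x ∈ Set.Icc (0 : ℝ) 1) {i c : Fin N} (hci : c ≠ i)
    (hc : ∀ j, j ≠ i → y j ≤ y c) (hinj : Function.Injective y)
    (hyi : y i ∈ Set.Icc lo hi) (hyr : ∀ j, j ≠ i → y j ∈ Set.Ioo lo hi) (v : ℝ) :
    netPayoff r (candidate ψ z r w) i v y ≤ truthfulPayoff z r i c v y ∧
      (v = y i → netPayoff r (candidate ψ z r w) i v y = truthfulPayoff z r i c v y) := by
  have hr0 := hz0.trans hzr
  obtain ⟨hw0, hw1⟩ := hw y
  obtain ⟨a, b, h⟩ := exists_isTopTwo hN hinj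
  set m := (Finset.univ.erase i).fold max r y with hm
  have hmax : m = max r (y c) := fold_max_eq r y (by simp [hci]) fun j hj => hc j (by simpa using hj)
  -- Even if `i` reports `lo`, the highest report lies strictly above `lo`, since it exceeds a
  -- rival's value or is one.
  have hya : 0 ≤ ψ (y a) ↔ z ≤ y a := by
    refine hψ _ ⟨?_, ?_⟩
    · rcases eq_or_ne a i with rfl | ha
      · exact (hyr b h.ne).1.trans h.lt
      · exact (hyr a ha).1
    · rcases eq_or_ne a i with rfl | ha
      · exact hyi.2
      · exact (hyr a ha).2.le
  rcases eq_or_ne a i with rfl | hai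
  · -- buyer `i` reports the highest value
    obtain rfl : b = c := hinj (le_antisymm (hc b h.ne) (h.le_snd hci))
    rcases lt_or_ge (ψ (y a)) 0 with hneg | hpos
    · have hqz : y a < z := not_le.1 fun e => hneg.not_ge (hya.2 e)
      have hbr : y b < r := h.lt.trans (hqz.trans_le hzr)
      rw [netPayoff_of_neg h hneg, truthfulPayoff, if_pos hbr, secondPriceSurplus, ← hm, hmax,
        max_eq_left hbr.le, max_eq_left (h.lt.trans hqz).le]
      refine ⟨max_le_max_right _ (by linarith), ?_⟩
      rintro rfl
      rw [max_eq_right, max_eq_right] <;> linarith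
    · have hqz := hya.1 hpos
      rcases lt_or_ge (y b) r with hbr | hbr
      · rw [netPayoff_of_lt h hpos hbr, if_pos rfl, truthfulPayoff, if_pos hbr]
        refine ⟨le_max_left _ _, ?_⟩
        rintro rfl
        exact (max_eq_left (sub_nonneg.2 (max_le hqz h.lt.le))).symm
      -- Both branches carry the price `M`: the first unit must be paid for, whereas the second
      -- auction lets the buyer decline. For a truthful top bidder `M` is below his value, so they
      -- agree.
      · rw [netPayoff_of_le h hpos hbr hr0, if_pos rfl, if_neg h.ne, truthfulPayoff,
          if_neg hbr.not_gt, secondPriceSurplus]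
        set M := ((Finset.univ.erase a).erase b).fold max r y with hM
        refine ⟨by nlinarith [le_max_left (v - M) 0], ?_⟩
        rintro rfl
        have : M ≤ y a := Finset.fold_max_le _ |>.2
          ⟨hbr.trans h.lt.le, fun j hj => (h.le_snd (by simp at hj; tauto)).trans h.lt.le⟩
        rw [max_eq_left (sub_nonneg.2 this)]
        ring
  · -- the strongest rival reports the highest value
    obtain rfl : a = c := by
      by_contra hac
      exact ((h.le_snd (Ne.symm hac)).trans_lt h.lt).not_ge (hc a hai)
    rcases lt_or_ge (ψ (y a)) 0 with hneg | hpos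
    · have haz : y a < z := not_le.1 fun e => hneg.not_ge (hya.2 e)
      rw [netPayoff_of_neg h hneg]
      refine ⟨secondPriceSurplus_le_truthfulPayoff hzr hci v y, ?_⟩
      rintro rfl
      have hia := (h.le_snd hai.symm).trans h.lt.le
      rw [truthfulPayoff_eq_zero (hia.trans haz.le) hzr, secondPriceSurplus,
        max_eq_right]
      exact sub_nonpos.2 (hia.trans (le_fold_max_of_mem r y (by simp [hai])))
    have haz := hya.1 hpos
    set M := ((Finset.univ.erase i).erase a).fold max r y with hM
    rcases lt_or_ge (y b) r with hbr | hbr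
    · have hMr : M = r := fold_max_eq_base r y fun j hj =>
        (h.le_snd (Finset.ne_of_mem_erase hj)).trans hbr.le
      rw [netPayoff_of_lt h hpos hbr, if_neg hai, truthfulPayoff, secondPriceSurplus, ← hM, hMr]
      have hib := h.le_snd hai.symm
      split_ifs with har
      · refine ⟨max_le_max_right _ (sub_le_sub_left (max_le hzr har.le) _), ?_⟩
        rintro rfl
        rw [max_eq_right (by linarith), max_eq_right]
        exact sub_nonpos.2 ((hib.trans h.lt.le).trans (le_max_right _ _))
      · exact ⟨le_rfl, fun _ => rfl⟩
    · rw [netPayoff_of_le h hpos hbr hr0, if_neg hai, truthfulPayoff,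
        if_neg (hbr.trans h.lt.le).not_gt]
      rcases eq_or_ne b i with rfl | hbi
      · have hM' : ((Finset.univ.erase a).erase b).fold max r y = M := by
          rw [hM, Finset.erase_right_comm]
        rw [if_pos rfl, secondPriceSurplus, ← hM, hM']
        refine ⟨by nlinarith [le_max_left (v - M) 0], ?_⟩
        rintro rfl
        have : M ≤ y b := Finset.fold_max_le _ |>.2
          ⟨hbr, fun j hj => h.le_snd (Finset.ne_of_mem_erase hj)⟩
        rw [max_eq_left (sub_nonneg.2 this)]
        ring
      -- Below the top two, the buyer meets `b` if `a` is served and `a` if `b` is served. The first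
      -- price is the lower one, and a truthful buyer can gain at neither.
      · rw [if_neg hbi, secondPriceSurplus, secondPriceSurplus, ← hM]
        have hMb : M = y b := by
          rw [hM, fold_max_eq r y (i := b) (by simp [hbi, h.ne])
            fun j hj => h.le_snd (Finset.ne_of_mem_erase hj), max_eq_right hbr]
        have ha' : y a ≤ ((Finset.univ.erase i).erase b).fold max r y :=
          le_fold_max_of_mem r y (by simp [hai, h.ne.symm])
        set M' := ((Finset.univ.erase i).erase b).fold max r y
        have hle : max (v - M') 0 ≤ max (v - M) 0 :=
          max_le_max_right _ (by rw [hMb]; linarith [h.lt])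
        refine ⟨by nlinarith, ?_⟩
        rintro rfl
        have hib := h.le_snd hai.symm
        rw [max_eq_right (by linarith), max_eq_right (by linarith [h.lt])]
        ring

end Candidate

/-! ### Pointwise maximization of virtual surplus -/

/-- The integrand of the first seller's expected revenue from buyer `i`: the virtual value of
buyer `i` if he gets the good, and his virtual surplus in the second auction otherwise. -/
def virtualSurplus (ψ : ℝ → ℝ) (r : ℝ) (P : (Fin N → ℝ) → Fin N → ℝ) (i : Fin N)
    (x : Fin N → ℝ) : ℝ :=
  lottery (P x) i (ψ (x i)) fun S => if S.fold max r x ≤ x i then ψ (x i) - S.fold max r x else 0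

/-- Sum over the buyers of the virtual surpluses when the good goes to `j`. -/
def winnerSurplus (ψ : ℝ → ℝ) (r : ℝ) (x : Fin N → ℝ) (j : Fin N) : ℝ :=
  ∑ i, if j = i then ψ (x i) else
    if ((Finset.univ.erase i).erase j).fold max r x ≤ x i then
      ψ (x i) - ((Finset.univ.erase i).erase j).fold max r x else 0

/-- Sum over the buyers of the virtual surpluses when the good is not allocated. -/
def noWinnerSurplus (ψ : ℝ → ℝ) (r : ℝ) (x : Fin N → ℝ) : ℝ :=
  ∑ i, if (Finset.univ.erase i).fold max r x ≤ x i then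
    ψ (x i) - (Finset.univ.erase i).fold max r x else 0

lemma sum_virtualSurplus (ψ : ℝ → ℝ) (r : ℝ) (P : (Fin N → ℝ) → Fin N → ℝ) (x : Fin N → ℝ) :
    ∑ i, virtualSurplus ψ r P i x =
      ∑ j, P x j * winnerSurplus ψ r x j + (1 - ∑ j, P x j) * noWinnerSurplus ψ r x := by
  simp only [virtualSurplus, lottery_eq_sum, winnerSurplus, noWinnerSurplus,
    Finset.sum_add_distrib, Finset.mul_sum]
  rw [Finset.sum_comm]

section Maximization

variable {ψ : ℝ → ℝ} {r : ℝ} {x : Fin N → ℝ} {a b : Fin N}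

/-- With `a` served, only `b` can win the second auction, subject to the reserve price. -/
lemma winnerSurplus_fst (h : IsTopTwo x a b) :
    winnerSurplus ψ r x a = ψ (x a) + if r ≤ x b then
      ψ (x b) - ((Finset.univ.erase a).erase b).fold max r x else 0 := by
  rw [winnerSurplus, Finset.sum_eq_add a b h.ne.symm, if_pos rfl, if_neg h.ne.symm,
    Finset.erase_right_comm]
  · congr 1
    refine if_congr ⟨(le_fold_max_base _ _ _).trans, fun hr => Finset.fold_max_le _ |>.2
      ⟨hr, fun j hj => h.le_snd (by simp at hj; tauto)⟩⟩ rfl rfl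
  · rintro i - ⟨hia, hib⟩
    rw [if_neg hia.symm, if_neg]
    exact fun hle => (h.lt_of_ne i hia hib).not_ge
      ((le_fold_max_of_mem r x (by simp [hib.symm, h.ne])).trans hle)
  · simp
  · simp

/-- With `a` still in the second auction, nobody else can win it. -/
lemma winnerSurplus_of_ne (h : IsTopTwo x a b) {j : Fin N} (hj : j ≠ a) :
    winnerSurplus ψ r x j = ψ (x j) + if r ≤ x a then
      ψ (x a) - ((Finset.univ.erase a).erase j).fold max r x else 0 := by
  rw [winnerSurplus, Finset.sum_eq_add j a hj, if_pos rfl, if_neg hj]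
  · congr 1
    refine if_congr ⟨(le_fold_max_base _ _ _).trans, fun hr => Finset.fold_max_le _ |>.2
      ⟨hr, fun k hk => (h.le_snd (by simp at hk; tauto)).trans h.lt.le⟩⟩ rfl rfl
  · rintro i - ⟨hij, hia⟩
    rw [if_neg hij.symm, if_neg]
    exact fun hle => ((h.le_snd hia).trans_lt h.lt).not_ge
      ((le_fold_max_of_mem r x (by simp [hia.symm, hj.symm])).trans hle)
  · simp
  · simp

lemma noWinnerSurplus_eq (h : IsTopTwo x a b) :
    noWinnerSurplus ψ r x = if r ≤ x a then ψ (x a) - max r (x b) else 0 := by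
  rw [noWinnerSurplus, Finset.sum_eq_single a]
  · rw [fold_max_eq r x (i := b) (by simp [h.ne]) fun j hj => h.le_snd (by simpa using hj)]
    exact if_congr ⟨(le_max_left _ _).trans, fun hr => max_le hr h.lt.le⟩ rfl rfl
  · rintro i - hia
    rw [if_neg]
    exact fun hle => ((h.le_snd hia).trans_lt h.lt).not_ge
      ((le_fold_max_of_mem r x (by simp [hia.symm])).trans hle)
  · simp

variable {lo hi z : ℝ}

lemma surplus_le_of_nonneg (h : IsTopTwo x a b) (hx : ∀ j, x j ∈ Set.Ioo lo hi)
    (hψz : ∀ t ∈ Set.Ioc lo hi, 0 ≤ ψ t ↔ z ≤ t) (hψm : MonotoneOn ψ (Set.Ioo lo hi))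
    (hψle : ∀ t ∈ Set.Ioo lo hi, ψ t ≤ t) (hz0 : 0 ≤ z) (hzr : z ≤ r) (hpos : 0 ≤ ψ (x a)) :
    (∀ j, winnerSurplus ψ r x j ≤ winnerSurplus ψ r x a) ∧
      noWinnerSurplus ψ r x ≤ winnerSurplus ψ r x a ∧
      (r ≤ x b → winnerSurplus ψ r x b = winnerSurplus ψ r x a) := by
  set M := ((Finset.univ.erase a).erase b).fold max r x with hM
  have hMb : r ≤ x b → M ≤ x b := fun hb => Finset.fold_max_le _ |>.2
    ⟨hb, fun j hj => h.le_snd (by simp at hj; tauto)⟩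
  have hab := h.lt
  have key : r ≤ x b → winnerSurplus ψ r x b = winnerSurplus ψ r x a := fun hb => by
    rw [winnerSurplus_fst h, winnerSurplus_of_ne h h.ne, ← hM, if_pos hb,
      if_pos (hb.trans h.lt.le)]
    ring
  refine ⟨fun j => ?_, ?_, key⟩
  · rcases eq_or_ne j a with rfl | hj
    · exact le_rfl
    have hjb := h.le_snd hj
    have hψjb := hψm (hx j) (hx b) hjb
    have hψja := hψm (hx j) (hx a) (hjb.trans h.lt.le)
    rcases lt_or_ge (x b) r with hb | hb
    · rw [winnerSurplus_fst h, winnerSurplus_of_ne h hj, if_neg hb.not_ge]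
      split_ifs
      -- The gain `ψ (x j) ≤ x j < r` from serving `j` does not cover the price, at least `r`, that
      -- is subtracted from the surplus of `a`.
      · have := le_fold_max_base r ((Finset.univ.erase a).erase j) x
        linarith [hψle _ (hx j)]
      · linarith
    · rcases eq_or_ne j b with rfl | hjb'
      · exact (key hb).le
      have h1 := hMb hb
      have h2 : x b ≤ ((Finset.univ.erase a).erase j).fold max r x :=
        le_fold_max_of_mem r x (by simp [h.ne, hjb'.symm])
      rw [winnerSurplus_fst h, winnerSurplus_of_ne h hj, if_pos hb, if_pos (hb.trans h.lt.le),
        ← hM]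
      linarith
  · rw [winnerSurplus_fst h, noWinnerSurplus_eq h, ← hM]
    rcases lt_or_ge (x b) r with hb | hb
    · rw [if_neg hb.not_ge, max_eq_left hb.le]
      split_ifs <;> linarith
    · have h1 := hMb hb
      -- Serving `a` leaves the second unit to `b`, whose virtual value is nonnegative as `z ≤ r ≤ x
      -- b`, and lowers the price from `x b` to `M`.
      have h2 := (hψz (x b) ⟨(hx b).1, (hx b).2.le⟩).2 (hzr.trans hb)
      rw [if_pos hb, if_pos (hb.trans h.lt.le), max_eq_right hb]
      linarith

lemma surplus_nonpos_of_neg (h : IsTopTwo x a b) (hx : ∀ j, x j ∈ Set.Ioo lo hi)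
    (hψz : ∀ t ∈ Set.Ioc lo hi, 0 ≤ ψ t ↔ z ≤ t) (hψm : MonotoneOn ψ (Set.Ioo lo hi))
    (hzr : z ≤ r) (hneg : ψ (x a) < 0) :
    (∀ j, winnerSurplus ψ r x j ≤ 0) ∧ noWinnerSurplus ψ r x = 0 := by
  have haz : x a < z := not_le.1 fun e => hneg.not_ge ((hψz _ ⟨(hx a).1, (hx a).2.le⟩).2 e)
  have har : ¬ r ≤ x a := (haz.trans_le hzr).not_ge
  have hbr : ¬ r ≤ x b := fun hb => har (hb.trans h.lt.le)
  refine ⟨fun j => ?_, by rw [noWinnerSurplus_eq h, if_neg har]⟩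
  rcases eq_or_ne j a with rfl | hj
  · rw [winnerSurplus_fst h, if_neg hbr]; linarith
  · rw [winnerSurplus_of_ne h hj, if_neg har]
    linarith [hψm (hx j) (hx a) ((h.le_snd hj).trans h.lt.le)]

lemma sum_virtualSurplus_le_candidate (hN : 2 ≤ N) (hinj : Function.Injective x)
    (hx : ∀ j, x j ∈ Set.Ioo lo hi)
    (hψz : ∀ t ∈ Set.Ioc lo hi, 0 ≤ ψ t ↔ z ≤ t) (hψm : MonotoneOn ψ (Set.Ioo lo hi))
    (hψle : ∀ t ∈ Set.Ioo lo hi, ψ t ≤ t) (hz0 : 0 ≤ z) (hzr : z ≤ r)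
    {P : (Fin N → ℝ) → Fin N → ℝ} (hP : ∀ j, 0 ≤ P x j) (hP1 : ∑ j, P x j ≤ 1)
    (w : (Fin N → ℝ) → ℝ) :
    ∑ i, virtualSurplus ψ r P i x ≤ ∑ i, virtualSurplus ψ r (candidateAlloc ψ r w) i x := by
  obtain ⟨a, b, h⟩ := exists_isTopTwo hN hinj
  have bound : ∀ V, (∀ j, winnerSurplus ψ r x j ≤ V) → noWinnerSurplus ψ r x ≤ V →
      ∑ i, virtualSurplus ψ r P i x ≤ V := fun V h1 h2 => by
    have h3 : ∑ j, P x j * winnerSurplus ψ r x j ≤ (∑ j, P x j) * V := by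
      rw [Finset.sum_mul]
      exact Finset.sum_le_sum fun j _ => mul_le_mul_of_nonneg_left (h1 j) (hP j)
    have h4 := mul_le_mul_of_nonneg_left h2 (sub_nonneg.2 hP1)
    rw [sum_virtualSurplus]
    linarith
  rcases lt_or_ge (ψ (x a)) 0 with hneg | hpos
  · obtain ⟨h1, h2⟩ := surplus_nonpos_of_neg h hx hψz hψm hzr hneg
    refine (bound 0 h1 h2.le).trans_eq ?_
    rw [sum_virtualSurplus, candidateAlloc_of_neg h hneg]
    simp [h2]
  · obtain ⟨h1, h2, h3⟩ := surplus_le_of_nonneg h hx hψz hψm hψle hz0 hzr hpos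
    refine (bound _ h1 h2).trans_eq ?_
    rw [sum_virtualSurplus]
    rcases lt_or_ge (x b) r with hb | hb
    · rw [candidateAlloc_of_lt h hpos hb]
      simp
    · rw [candidateAlloc_of_le h hpos hb]
      simp [add_mul, Finset.sum_add_distrib, h3 hb]
      ring

end Maximization

/-! ### Envelope theorem -/

section Subgradient

variable {U g : ℝ → ℝ} {a b : ℝ}

/-- Envelope theorem: a function with bounded subgradients `g` is the integral of `g`. -/
lemma sub_eq_integral_of_subgradient (hab : a ≤ b) {C : ℝ} (hC : ∀ s ∈ Set.Icc a b, |g s| ≤ C)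
    (h : ∀ s ∈ Set.Icc a b, ∀ v ∈ Set.Icc a b, U s + (v - s) * g s ≤ U v) :
    U b - U a = ∫ s in a..b, g s := by
  -- Adding the subgradient inequalities at two points gives monotonicity, so `g` has at most
  -- countably many discontinuities.
  have hmono : MonotoneOn g (Set.Icc a b) := by
    intro s hs v hv hsv
    rcases hsv.eq_or_lt with rfl | hlt
    · exact le_rfl
    have h1 := h s hs v hv
    have h2 := h v hv s hs
    by_contra! hgt
    nlinarith
  have hC0 : 0 ≤ C := (abs_nonneg _).trans (hC a (Set.left_mem_Icc.2 hab))
  have hcont : ContinuousOn U (Set.Icc a b) := by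
    refine (LipschitzOnWith.of_dist_le_mul (K := ⟨C, hC0⟩) fun s hs v hv => ?_).continuousOn
    have h1 := h s hs v hv
    have h2 := h v hv s hs
    have e1 : |(v - s) * g s| ≤ C * |s - v| := by
      rw [abs_mul, mul_comm, abs_sub_comm]
      exact mul_le_mul_of_nonneg_right (hC s hs) (abs_nonneg _)
    have e2 : |(s - v) * g v| ≤ C * |s - v| := by
      rw [abs_mul, mul_comm]
      exact mul_le_mul_of_nonneg_right (hC v hv) (abs_nonneg _)
    rw [Real.dist_eq, Real.dist_eq]
    change |U s - U v| ≤ C * |s - v|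
    rw [abs_le] at e1 e2 ⊢
    constructor <;> linarith [e1.1, e1.2, e2.1, e2.2]
  refine (integral_eq_of_hasDerivAt_off_countable_of_le U g hab
    hmono.countable_not_continuousWithinAt hcont ?_ ?_).symm
  · rintro s ⟨hs, hns⟩
    have hsI : s ∈ Set.Icc a b := Set.Ioo_subset_Icc_self hs
    have hgc : ContinuousAt g s := by
      have : ContinuousWithinAt g (Set.Icc a b) s := by
        by_contra hc
        exact hns ⟨hsI, hc⟩
      exact this.continuousAt (Icc_mem_nhds hs.1 hs.2)
    rw [hasDerivAt_iff_isLittleO, Asymptotics.isLittleO_iff]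
    intro ε hε
    filter_upwards [Icc_mem_nhds hs.1 hs.2, Metric.continuousAt_iff'.1 hgc ε hε] with v hv hgv
    -- The remainder `U v - U s - (v - s) * g s` lies between `0` and `(v - s) * (g v - g s)`, hence
    -- is `o(v - s)` where `g` is continuous.
    have h1 := h s hsI v hv
    have h2 := h v hv s hsI
    have h3 : |(v - s) * (g v - g s)| ≤ ε * |v - s| := by
      rw [abs_mul, mul_comm]
      exact mul_le_mul_of_nonneg_right hgv.le (abs_nonneg _)
    rw [Real.norm_eq_abs, Real.norm_eq_abs, smul_eq_mul]
    rw [abs_of_nonneg (by linarith)]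
    linarith [(abs_le.1 h3).2]
  · exact MonotoneOn.intervalIntegrable (by rwa [Set.uIcc_of_le hab])

end Subgradient

/-! ### Random profiles and interim expectations -/

section Profiles

variable {μ : Measure ℝ} [IsProbabilityMeasure μ]

/-- Replacing a coordinate of a random profile by an independent draw preserves the law. -/
lemma measurePreserving_update (i : Fin N) :
    MeasurePreserving (fun p : ℝ × (Fin N → ℝ) => Function.update p.2 i p.1)
      (μ.prod (Measure.pi fun _ : Fin N => μ)) (Measure.pi fun _ : Fin N => μ) := by
  have hm : Measurable fun p : ℝ × (Fin N → ℝ) => Function.update p.2 i p.1 :=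
    measurable_update'.comp measurable_swap
  refine ⟨hm, (Measure.pi_eq fun s hs => ?_).symm⟩
  rw [Measure.map_apply hm (MeasurableSet.univ_pi hs)]
  have : (fun p : ℝ × (Fin N → ℝ) => Function.update p.2 i p.1) ⁻¹' Set.univ.pi s =
      s i ×ˢ Set.univ.pi (Function.update s i Set.univ) := by
    ext p
    simp only [Set.mem_preimage, Set.mem_pi, Set.mem_univ, true_imp_iff, Set.mem_prod]
    constructor
    · refine fun h => ⟨by simpa using h i, fun j => ?_⟩
      rcases eq_or_ne j i with rfl | hj
      · simp
      · simpa [Function.update_of_ne hj] using h j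
    · rintro ⟨h1, h2⟩ j
      rcases eq_or_ne j i with rfl | hj
      · simpa using h1
      · simpa [Function.update_of_ne hj] using h2 j
  rw [this, Measure.prod_prod, Measure.pi_pi, ← Finset.mul_prod_erase _ _ (Finset.mem_univ i),
    ← Finset.mul_prod_erase _ (fun j => μ (s j)) (Finset.mem_univ i)]
  simp only [Function.update_self, measure_univ, one_mul]
  congr 1
  exact Finset.prod_congr rfl fun j hj => by
    rw [Function.update_of_ne (Finset.ne_of_mem_erase hj)]

lemma measurable_update_profile (i : Fin N) (q : ℝ) :
    Measurable fun x : Fin N → ℝ => Function.update x i q :=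
  measurable_update'.comp (measurable_id.prodMk measurable_const)

lemma integrable_interim (i : Fin N) {G : (Fin N → ℝ) → ℝ}
    (hG : Integrable G (Measure.pi fun _ : Fin N => μ)) :
    Integrable (fun q => interim μ i q G) μ :=
  (((measurePreserving_update i).integrable_comp hG.aestronglyMeasurable).2 hG).integral_prod_left

lemma integral_interim (i : Fin N) {G : (Fin N → ℝ) → ℝ}
    (hG : Integrable G (Measure.pi fun _ : Fin N => μ)) :
    ∫ q, interim μ i q G ∂μ = ∫ x, G x ∂(Measure.pi fun _ : Fin N => μ) := by
  have hmp := measurePreserving_update (μ := μ) i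
  have hG' := (hmp.integrable_comp hG.aestronglyMeasurable).2 hG
  have h := integral_prod _ hG'
  simp only [Function.comp_apply] at h
  simp only [interim]
  rw [← h, ← integral_map hmp.measurable.aemeasurable
    (by rw [hmp.map_eq]; exact hG.aestronglyMeasurable), hmp.map_eq]

lemma measurable_interim (i : Fin N) {G : (Fin N → ℝ) → ℝ} (hG : Measurable G) :
    Measurable fun q => interim μ i q G :=
  (hG.comp (measurePreserving_update (μ := μ) i).measurable).stronglyMeasurable.integral_prod_right'
    |>.measurable

lemma ae_forall_mem {A : Set ℝ} (hA : ∀ᵐ t ∂μ, t ∈ A) :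
    ∀ᵐ x ∂(Measure.pi fun _ : Fin N => μ), ∀ j, x j ∈ A :=
  ae_all_iff.2 fun j =>
    (measurePreserving_eval (fun _ : Fin N => μ) j).quasiMeasurePreserving.ae hA

lemma ae_forall_ne [NullSingletonClass μ] (q : ℝ) :
    ∀ᵐ x ∂(Measure.pi fun _ : Fin N => μ), ∀ j, x j ≠ q :=
  ae_forall_mem (A := {q}ᶜ) (compl_mem_ae_iff.2 (measure_singleton q))

/-- Redrawing coordinate `i` independently reduces a tie to the event that `x j` hits a fixed value,
which is null. -/
lemma ae_injective [NullSingletonClass μ] :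
    ∀ᵐ x ∂(Measure.pi fun _ : Fin N => μ), Function.Injective x := by
  have key : ∀ i j : Fin N, i ≠ j → ∀ᵐ x ∂(Measure.pi fun _ : Fin N => μ), x i ≠ x j := by
    intro i j hij
    have hS : MeasurableSet {x : Fin N → ℝ | x i ≠ x j} :=
      (measurableSet_eq_fun (measurable_pi_apply i) (measurable_pi_apply j)).compl
    have hmp := measurePreserving_update (μ := μ) i
    rw [← hmp.map_eq, ae_map_iff hmp.measurable.aemeasurable hS]
    refine (Measure.ae_prod_iff_ae_ae (hmp.measurable hS)).2
      (Filter.Eventually.of_forall fun q => ?_)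
    filter_upwards [ae_forall_ne q] with x hx
    simpa [Function.update_of_ne hij.symm] using (hx j).symm
  have : ∀ᵐ x ∂(Measure.pi fun _ : Fin N => μ), ∀ i j : Fin N, i ≠ j → x i ≠ x j := by
    simp only [ae_all_iff]
    exact key
  filter_upwards [this] with x hx i j hij
  by_contra hne
  exact hx i j hne hij

lemma injective_update {x : Fin N → ℝ} (hx : Function.Injective x) (i : Fin N) {q : ℝ}
    (hq : ∀ j, x j ≠ q) : Function.Injective (Function.update x i q) := by
  intro j k hjk
  by_cases hj : j = i <;> by_cases hk : k = i
  · rw [hj, hk]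
  · rw [hj, Function.update_self, Function.update_of_ne hk] at hjk
    exact absurd hjk.symm (hq k)
  · rw [hk, Function.update_self, Function.update_of_ne hj] at hjk
    exact absurd hjk (hq j)
  · rw [Function.update_of_ne hk, Function.update_of_ne hj] at hjk
    exact hx hjk

lemma update_mem {A : Set ℝ} {x : Fin N → ℝ} (hx : ∀ j, x j ∈ A) (i : Fin N) {q : ℝ}
    (hq : q ∈ A) (j : Fin N) : Function.update x i q j ∈ A := by
  rcases eq_or_ne j i with rfl | hj
  · simpa using hq
  · simpa [Function.update_of_ne hj] using hx j

lemma integrable_of_bound_box {A : Set ℝ} (hA : ∀ᵐ t ∂μ, t ∈ A) {G : (Fin N → ℝ) → ℝ}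
    (hG : Measurable G) {C : ℝ} (hC : ∀ x, (∀ j, x j ∈ A) → |G x| ≤ C) :
    Integrable G (Measure.pi fun _ : Fin N => μ) :=
  Integrable.of_bound hG.aestronglyMeasurable C
    (by filter_upwards [ae_forall_mem hA] with x hx using hC x hx)

lemma integrable_update_of_bound_box {A : Set ℝ} (hA : ∀ᵐ t ∂μ, t ∈ A) {G : (Fin N → ℝ) → ℝ}
    (hG : Measurable G) {C : ℝ} (hC : ∀ x, (∀ j, x j ∈ A) → |G x| ≤ C) (i : Fin N) {q : ℝ}
    (hq : q ∈ A) :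
    Integrable (fun x => G (Function.update x i q)) (Measure.pi fun _ : Fin N => μ) :=
  integrable_of_bound_box hA (hG.comp (measurable_update_profile i q))
    fun _ hx => hC _ (update_mem hx i hq)

end Profiles

/-! ### Inverse hazard rate and integration by parts -/

section Hazard

variable {μ : Measure ℝ} {f : ℝ → ℝ} {lo hi : ℝ}

lemma measurable_of_density (hf_cont : ContinuousOn f (Set.Icc lo hi))
    (hf_zero : ∀ x, x ∉ Set.Icc lo hi → f x = 0) : Measurable f := by
  classical
  have : f = (Set.Icc lo hi).piecewise f 0 := by
    ext x
    by_cases hx : x ∈ Set.Icc lo hi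
    · rw [Set.piecewise_eq_of_mem _ _ _ hx]
    · rw [Set.piecewise_eq_of_notMem _ _ _ hx, hf_zero x hx, Pi.zero_apply]
  rw [this]
  exact hf_cont.measurable_piecewise continuousOn_const measurableSet_Icc

/-- The inverse hazard rate `(1 - F) / f`. -/
def inverseHazard (μ : Measure ℝ) (f : ℝ → ℝ) (x : ℝ) : ℝ :=
  (1 - ProbabilityTheory.cdf μ x) / f x

lemma virtualValue_eq (μ : Measure ℝ) (f : ℝ → ℝ) (x : ℝ) :
    virtualValue μ f x = x - inverseHazard μ f x := rfl

lemma virtualValue_le (hf_pos : ∀ x ∈ Set.Ioo lo hi, 0 < f x) {t : ℝ} (ht : t ∈ Set.Ioo lo hi) :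
    virtualValue μ f t ≤ t :=
  sub_le_self _ (div_nonneg (sub_nonneg.2 (ProbabilityTheory.cdf_le_one μ t)) (hf_pos t ht).le)

lemma measurable_inverseHazard (hf : Measurable f) : Measurable (inverseHazard μ f) :=
  (measurable_const.sub (ProbabilityTheory.monotone_cdf μ).measurable).div hf

lemma measurable_virtualValue (hf : Measurable f) : Measurable (virtualValue μ f) :=
  measurable_id.sub (measurable_inverseHazard hf)

lemma nullSingletonClass_of_density
    (hμ : μ = volume.withDensity fun x => ENNReal.ofReal (f x)) :
    NullSingletonClass μ := by
  rw [hμ]; exact nullSingletonClass_withDensity _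

lemma ae_mem_Ioo (hf_zero : ∀ x, x ∉ Set.Icc lo hi → f x = 0) (hf : Measurable f)
    (hμ : μ = volume.withDensity fun x => ENNReal.ofReal (f x)) :
    ∀ᵐ t ∂μ, t ∈ Set.Ioo lo hi := by
  have := nullSingletonClass_of_density hμ
  have h1 : ∀ᵐ t ∂μ, t ∈ Set.Icc lo hi := by
    rw [hμ, ae_withDensity_iff hf.ennreal_ofReal]
    refine Filter.Eventually.of_forall fun t ht => ?_
    by_contra hc
    exact ht (by rw [hf_zero t hc, ENNReal.ofReal_zero])
  filter_upwards [h1, compl_mem_ae_iff.2 (measure_singleton (μ := μ) lo),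
    compl_mem_ae_iff.2 (measure_singleton (μ := μ) hi)] with t ht h2 h3
  exact ⟨lt_of_le_of_ne ht.1 (Ne.symm h2), lt_of_le_of_ne ht.2 h3⟩

/-- The density cancels against the denominator; the endpoints, where it may vanish, are a null set.
This makes the possibly unbounded inverse hazard rate integrable. -/
lemma density_smul_inverseHazard (hf_pos : ∀ x ∈ Set.Ioo lo hi, 0 < f x)
    (hf_zero : ∀ x, x ∉ Set.Icc lo hi → f x = 0) (k : ℝ → ℝ) :
    (fun s => (ENNReal.ofReal (f s)).toReal • (inverseHazard μ f s * k s)) =ᵐ[volume]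
      (Set.Ioc lo hi).indicator fun s => (1 - ProbabilityTheory.cdf μ s) * k s := by
  filter_upwards [compl_mem_ae_iff.2 (measure_singleton (μ := volume) lo),
    compl_mem_ae_iff.2 (measure_singleton (μ := volume) hi)] with s h2 h3
  by_cases hs : s ∈ Set.Icc lo hi
  · have hs' : s ∈ Set.Ioo lo hi := ⟨lt_of_le_of_ne hs.1 (Ne.symm h2), lt_of_le_of_ne hs.2 h3⟩
    have h := hf_pos s hs'
    rw [Set.indicator_of_mem (Set.Ioo_subset_Ioc_self hs'), ENNReal.toReal_ofReal h.le,
      inverseHazard, smul_eq_mul]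
    field_simp
  · rw [Set.indicator_of_notMem fun h => hs (Set.Ioc_subset_Icc_self h), hf_zero s hs]
    simp

lemma integrable_inverseHazard [IsProbabilityMeasure μ]
    (hf_pos : ∀ x ∈ Set.Ioo lo hi, 0 < f x) (hf_zero : ∀ x, x ∉ Set.Icc lo hi → f x = 0)
    (hf : Measurable f) (hμ : μ = volume.withDensity fun x => ENNReal.ofReal (f x)) :
    Integrable (inverseHazard μ f) μ := by
  have h : Integrable (fun s => inverseHazard μ f s * 1)
      (volume.withDensity fun x => ENNReal.ofReal (f x)) := by
    rw [integrable_withDensity_iff_integrable_smul' hf.ennreal_ofReal (by simp),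
      integrable_congr (density_smul_inverseHazard hf_pos hf_zero _),
      integrable_indicator_iff measurableSet_Ioc]
    refine Integrable.of_bound (((measurable_const.sub
      (ProbabilityTheory.monotone_cdf μ).measurable).mul measurable_const).aestronglyMeasurable) 1
      (Filter.Eventually.of_forall fun s => ?_)
    have h0 := ProbabilityTheory.cdf_nonneg μ s
    have h1 := ProbabilityTheory.cdf_le_one μ s
    rw [mul_one, Real.norm_eq_abs, abs_of_nonneg] <;> linarith
  rw [← hμ] at h
  simpa using h

/-- Integration by parts: the mean of an integral over lower types. -/
lemma integral_integral_lower [IsProbabilityMeasure μ]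
    (hf_pos : ∀ x ∈ Set.Ioo lo hi, 0 < f x) (hf_zero : ∀ x, x ∉ Set.Icc lo hi → f x = 0)
    (hf : Measurable f) (hμ : μ = volume.withDensity fun x => ENNReal.ofReal (f x))
    {g : ℝ → ℝ} (hg : Measurable g) {C : ℝ}
    (hC : ∀ s ∈ Set.Icc lo hi, |g s| ≤ C) :
    Integrable (fun v => ∫ s in lo..v, g s) μ ∧
      ∫ v, (∫ s in lo..v, g s) ∂μ = ∫ s, inverseHazard μ f s * g s ∂μ := by
  -- Fubini for the kernel `1_{s < v} g s`: integrating out `s` gives the lower integral,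
  -- integrating out `v` gives `(1 - F(s)) g s`.
  set F : ℝ → ℝ → ℝ := fun v s => (Set.Ioi s).indicator 1 v * g s with hF
  set ν := volume.restrict (Set.Ioc lo hi)
  have hFm : Measurable (Function.uncurry F) := by
    have : Function.uncurry F = fun p : ℝ × ℝ => (if p.2 < p.1 then 1 else 0) * g p.2 := by
      ext p
      simp [F, Function.uncurry, Set.indicator_apply]
    rw [this]
    exact (Measurable.ite (measurableSet_lt measurable_snd measurable_fst) measurable_const
      measurable_const).mul (hg.comp measurable_snd)
  have hFi : Integrable (Function.uncurry F) (μ.prod ν) := by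
    have hs : ∀ᵐ p ∂μ.prod ν, p.2 ∈ Set.Ioc lo hi :=
      Measure.quasiMeasurePreserving_snd.ae (ae_restrict_mem measurableSet_Ioc)
    refine Integrable.of_bound hFm.aestronglyMeasurable C ?_
    filter_upwards [hs] with p hp
    have hb := hC p.2 (Set.Ioc_subset_Icc_self hp)
    simp only [Function.uncurry, F, Set.indicator_apply, Real.norm_eq_abs]
    split_ifs
    · simpa using hb
    · simpa using (abs_nonneg _).trans hb
  have hin : ∀ᵐ v ∂μ, ∫ s, F v s ∂ν = ∫ s in lo..v, g s := by
    filter_upwards [ae_mem_Ioo hf_zero hf hμ] with v hv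
    rw [intervalIntegral.integral_of_le hv.1.le, integral_Ioc_eq_integral_Ioo (x := lo) (y := v),
      ← integral_indicator measurableSet_Ioo, ← integral_indicator measurableSet_Ioc]
    congr 1
    ext s
    by_cases h1 : lo < s <;> by_cases h2 : s < v
    · simp [Set.indicator_apply, F, h1, h2, (h2.trans hv.2).le]
    all_goals simp [Set.indicator_apply, F, h1, h2]
  refine ⟨hFi.integral_prod_left.congr hin, ?_⟩
  rw [← integral_congr_ae hin, integral_integral_swap hFi]
  have hout : ∀ s, ∫ v, F v s ∂μ = (1 - ProbabilityTheory.cdf μ s) * g s := by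
    intro s
    rw [integral_mul_const, integral_indicator_one measurableSet_Ioi, ProbabilityTheory.cdf_eq_real,
      ← Set.compl_Iic, probReal_compl_eq_one_sub measurableSet_Iic]
  simp only [hout]
  rw [← integral_indicator measurableSet_Ioc,
    ← integral_congr_ae (density_smul_inverseHazard hf_pos hf_zero g),
    ← integral_withDensity_eq_integral_toReal_smul hf.ennreal_ofReal (by simp), ← hμ]

end Hazard

/-! ### Gross payoff and its subgradient -/

section Gross

variable {r lo hi : ℝ} {P : (Fin N → ℝ) → Fin N → ℝ}

/-- A subgradient, with respect to the own value, of buyer `i`'s gross payoff at truthful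
reports: the probability that he gets one of the two units. -/
def winProb (r : ℝ) (P : (Fin N → ℝ) → Fin N → ℝ) (i : Fin N) (x : Fin N → ℝ) : ℝ :=
  lottery (P x) i 1 fun S => if S.fold max r x ≤ x i then 1 else 0

lemma measurable_winProb (hP : ∀ j, Measurable fun x => P x j) (i : Fin N) :
    Measurable (winProb r P i) :=
  measurable_lottery hP i measurable_const fun S =>
    Measurable.ite (measurableSet_le (measurable_fold_max r S) (measurable_pi_apply i))
      measurable_const measurable_const

lemma measurable_grossPayoff (hP : ∀ j, Measurable fun x => P x j) (i : Fin N)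
    {v : (Fin N → ℝ) → ℝ} (hv : Measurable v) :
    Measurable fun x => grossPayoff r P i (v x) x :=
  measurable_lottery hP i hv fun S => (hv.sub (measurable_fold_max r S)).max measurable_const

lemma measurable_secondPriceSurplus (v : ℝ) (S : Finset (Fin N)) :
    Measurable (secondPriceSurplus r v S) :=
  (measurable_const.sub (measurable_fold_max r S)).max measurable_const

lemma abs_winProb_le {x : Fin N → ℝ} (hP : ∀ j, 0 ≤ P x j) (hP1 : ∑ j, P x j ≤ 1) (i : Fin N) :
    |winProb r P i x| ≤ 1 :=
  abs_lottery_le hP hP1 i (by simp) fun S => by split_ifs <;> simp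

lemma abs_secondPriceSurplus_le (hr : 0 ≤ r) {v : ℝ} (hv0 : 0 ≤ v) (hv : v ≤ hi)
    (S : Finset (Fin N)) (x : Fin N → ℝ) : |secondPriceSurplus r v S x| ≤ hi := by
  have h := le_fold_max_base r S x
  unfold secondPriceSurplus
  rw [abs_of_nonneg (le_max_right _ _)]
  exact max_le (by linarith) (by linarith)

lemma abs_grossPayoff_le (hr : 0 ≤ r) {x : Fin N → ℝ} (hP : ∀ j, 0 ≤ P x j)
    (hP1 : ∑ j, P x j ≤ 1) (i : Fin N) {v : ℝ} (hv0 : 0 ≤ v) (hv : v ≤ hi) :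
    |grossPayoff r P i v x| ≤ hi :=
  abs_lottery_le hP hP1 i (by rwa [abs_of_nonneg hv0])
    fun S => abs_secondPriceSurplus_le hr hv0 hv S x

/-- Branch by branch, `max (v - p) 0` has subgradient `1_{p ≤ x i}` at `v = x i`; nonnegative
weights preserve the inequality. -/
lemma grossPayoff_subgradient {x : Fin N → ℝ} (hP : ∀ j, 0 ≤ P x j) (hP1 : ∑ j, P x j ≤ 1)
    (i : Fin N) (v : ℝ) :
    grossPayoff r P i (x i) x + (v - x i) * winProb r P i x ≤ grossPayoff r P i v x := by
  rw [grossPayoff_eq_lottery, grossPayoff_eq_lottery, winProb, ← lottery_const_mul, ← lottery_add]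
  refine lottery_mono hP hP1 i (by ring_nf; exact le_rfl) fun S => ?_
  unfold secondPriceSurplus
  split_ifs with h
  · rw [max_eq_left (sub_nonneg.2 h)]
    exact le_max_of_le_left (by ring_nf; exact le_rfl)
  · rw [max_eq_right (sub_nonpos.2 (not_le.1 h).le), mul_zero, add_zero]
    exact le_max_right _ _

lemma virtualSurplus_eq (μ : Measure ℝ) (f : ℝ → ℝ) (i : Fin N) (x : Fin N → ℝ) :
    virtualSurplus (virtualValue μ f) r P i x =
      grossPayoff r P i (x i) x - inverseHazard μ f (x i) * winProb r P i x := by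
  rw [grossPayoff_eq_lottery, winProb, sub_eq_add_neg, ← neg_mul, ← lottery_const_mul,
    ← lottery_add, virtualSurplus]
  congr 1
  · rw [virtualValue_eq]; ring
  · funext S
    unfold secondPriceSurplus
    rw [virtualValue_eq]
    split_ifs with h
    · rw [max_eq_left (sub_nonneg.2 h)]; ring
    · rw [max_eq_right (sub_nonpos.2 (not_le.1 h).le)]; ring

end Gross

/-! ### Payoff equivalence and the revenue formula -/

section Revenue

variable {μ : Measure ℝ} [IsProbabilityMeasure μ] {lo hi r : ℝ} {M : DirectMechanism N}

lemma integrable_grossPayoff_update (hlo : 0 ≤ lo) (hr : 0 ≤ r)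
    (hbox : ∀ᵐ t ∂μ, t ∈ Set.Icc lo hi) (hM : IsMechanism μ lo hi M) (i : Fin N) {q v : ℝ}
    (hq : q ∈ Set.Icc lo hi) (hv : v ∈ Set.Icc lo hi) :
    Integrable (fun x => grossPayoff r M.alloc i v (Function.update x i q))
      (Measure.pi fun _ : Fin N => μ) :=
  integrable_update_of_bound_box hbox
    (measurable_grossPayoff hM.measurable_alloc i measurable_const)
    (fun x hx => abs_grossPayoff_le hr (hM.alloc_nonneg x hx) (hM.sum_alloc_le x hx) i
      (hlo.trans hv.1) hv.2) i hq

lemma integrable_winProb_update (hbox : ∀ᵐ t ∂μ, t ∈ Set.Icc lo hi) (hM : IsMechanism μ lo hi M)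
    (i : Fin N) {q : ℝ} (hq : q ∈ Set.Icc lo hi) :
    Integrable (fun x => winProb r M.alloc i (Function.update x i q))
      (Measure.pi fun _ : Fin N => μ) :=
  integrable_update_of_bound_box hbox (measurable_winProb hM.measurable_alloc i)
    (fun x hx => abs_winProb_le (hM.alloc_nonneg x hx) (hM.sum_alloc_le x hx) i) i hq

lemma interimGross_subgradient (hlo : 0 ≤ lo) (hr : 0 ≤ r)
    (hbox : ∀ᵐ t ∂μ, t ∈ Set.Icc lo hi) (hM : IsMechanism μ lo hi M) (i : Fin N) {q v : ℝ}
    (hq : q ∈ Set.Icc lo hi) (hv : v ∈ Set.Icc lo hi) :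
    interimGross μ r M i q q + (v - q) * interim μ i q (winProb r M.alloc i) ≤
      interimGross μ r M i q v := by
  have h1 := integrable_grossPayoff_update hlo hr hbox hM i hq hq
  have h2 := (integrable_winProb_update (r := r) hbox hM i hq).const_mul (v - q)
  simp only [interimGross, interim]
  rw [← integral_const_mul, ← integral_add h1 h2]
  refine integral_mono_ae (h1.add h2) (integrable_grossPayoff_update hlo hr hbox hM i hq hv) ?_
  filter_upwards [ae_forall_mem hbox] with x hx
  have hx' := update_mem hx i hq
  simpa using grossPayoff_subgradient (r := r) (hM.alloc_nonneg _ hx') (hM.sum_alloc_le _ hx') i v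

lemma abs_interim_winProb_le (hbox : ∀ᵐ t ∂μ, t ∈ Set.Icc lo hi) (hM : IsMechanism μ lo hi M)
    (i : Fin N) {q : ℝ} (hq : q ∈ Set.Icc lo hi) :
    |interim μ i q (winProb r M.alloc i)| ≤ 1 := by
  have h := norm_integral_le_of_norm_le_const (C := 1)
    (f := fun x => winProb r M.alloc i (Function.update x i q))
    (μ := Measure.pi fun _ : Fin N => μ) (by
      filter_upwards [ae_forall_mem hbox] with x hx
      have hx' := update_mem hx i hq
      exact abs_winProb_le (hM.alloc_nonneg _ hx') (hM.sum_alloc_le _ hx') i)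
  simpa [interim] using h

/-- The payoff equivalence formula for the interim payment. -/
lemma interimPay_eq (hlo : 0 ≤ lo) (hr : 0 ≤ r)
    (hbox : ∀ᵐ t ∂μ, t ∈ Set.Icc lo hi) (hM : IsMechanism μ lo hi M)
    (hIC : IncentiveCompatible μ lo hi r M) (i : Fin N) {q : ℝ} (hq : q ∈ Set.Icc lo hi) :
    interimPay μ M i q = interimGross μ r M i q q
      - (interimGross μ r M i lo lo - interimPay μ M i lo)
      - ∫ s in lo..q, interim μ i s (winProb r M.alloc i) := by
  have hsub : Set.Icc lo q ⊆ Set.Icc lo hi := Set.Icc_subset_Icc_right hq.2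
  rw [← sub_eq_integral_of_subgradient
    (U := fun s => interimGross μ r M i s s - interimPay μ M i s) (C := 1) hq.1
    (fun s hs => abs_interim_winProb_le hbox hM i (hsub hs))
    fun s hs v hv => ?_]
  · ring
  -- Type `v` can imitate `s`; the subgradient inequality bounds his gross payoff from doing so, and
  -- the payment cancels.
  · have h1 := hIC i v (hsub hv) s (hsub hs)
    have h2 := interimGross_subgradient hlo hr hbox hM i (hsub hs) (hsub hv)
    linarith

variable {f : ℝ → ℝ}

/-- Expected payment of buyer `i`: his expected virtual surplus less the lowest type's rent. -/
lemma integral_interimPay (hlo : 0 ≤ lo) (hr : 0 ≤ r)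
    (hf_pos : ∀ x ∈ Set.Ioo lo hi, 0 < f x) (hf_zero : ∀ x, x ∉ Set.Icc lo hi → f x = 0)
    (hf : Measurable f) (hμ : μ = volume.withDensity fun x => ENNReal.ofReal (f x))
    (hM : IsMechanism μ lo hi M) (hIC : IncentiveCompatible μ lo hi r M) (i : Fin N) :
    Integrable (virtualSurplus (virtualValue μ f) r M.alloc i) (Measure.pi fun _ : Fin N => μ) ∧
      ∫ q, interimPay μ M i q ∂μ =
        ∫ x, virtualSurplus (virtualValue μ f) r M.alloc i x ∂(Measure.pi fun _ : Fin N => μ)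
          - (interimGross μ r M i lo lo - interimPay μ M i lo) := by
  have hbox : ∀ᵐ t ∂μ, t ∈ Set.Icc lo hi := by
    filter_upwards [ae_mem_Ioo hf_zero hf hμ] with t ht using Set.Ioo_subset_Icc_self ht
  have hwin : ∀ᵐ x ∂(Measure.pi fun _ : Fin N => μ), ‖winProb r M.alloc i x‖ ≤ 1 := by
    filter_upwards [ae_forall_mem hbox] with x hx
    exact abs_winProb_le (hM.alloc_nonneg _ hx) (hM.sum_alloc_le _ hx) i
  have hgross : Integrable (fun x => grossPayoff r M.alloc i (x i) x)
      (Measure.pi fun _ : Fin N => μ) :=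
    integrable_of_bound_box hbox
      (measurable_grossPayoff hM.measurable_alloc i (measurable_pi_apply i))
      fun x hx => abs_grossPayoff_le hr (hM.alloc_nonneg x hx) (hM.sum_alloc_le x hx) i
        (hlo.trans (hx i).1) (hx i).2
  have hhaz : Integrable (fun x : Fin N → ℝ => inverseHazard μ f (x i) * winProb r M.alloc i x)
      (Measure.pi fun _ : Fin N => μ) := by
    have hH := integrable_inverseHazard hf_pos hf_zero hf hμ
    have h1 : Integrable (fun x : Fin N → ℝ => inverseHazard μ f (x i))
        (Measure.pi fun _ : Fin N => μ) :=
      ((measurePreserving_eval (fun _ : Fin N => μ) i).integrable_comp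
        hH.aestronglyMeasurable).2 hH
    simpa only [mul_comm] using
      h1.bdd_mul (measurable_winProb hM.measurable_alloc i).aestronglyMeasurable hwin
  have hvs : virtualSurplus (virtualValue μ f) r M.alloc i = fun x =>
      grossPayoff r M.alloc i (x i) x - inverseHazard μ f (x i) * winProb r M.alloc i x :=
    funext fun x => virtualSurplus_eq μ f i x
  rw [hvs]
  refine ⟨hgross.sub hhaz, ?_⟩
  obtain ⟨hI, hE⟩ := integral_integral_lower hf_pos hf_zero hf hμ
    (measurable_interim (μ := μ) i (measurable_winProb (r := r) hM.measurable_alloc i))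
    (C := 1) fun s hs => abs_interim_winProb_le hbox hM i hs
  have hG : ∀ q, interimGross μ r M i q q =
      interim μ i q fun x => grossPayoff r M.alloc i (x i) x := fun q => by
    simp [interimGross, interim]
  have hW : ∀ q, inverseHazard μ f q * interim μ i q (winProb r M.alloc i) =
      interim μ i q fun x => inverseHazard μ f (x i) * winProb r M.alloc i x := fun q => by
    simp [interim, integral_const_mul]
  simp only [hW] at hE
  rw [integral_interim i hhaz] at hE
  have hGi := integrable_interim i hgross
  calc ∫ q, interimPay μ M i q ∂μ
      = ∫ q, ((interim μ i q fun x => grossPayoff r M.alloc i (x i) x)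
          - (interimGross μ r M i lo lo - interimPay μ M i lo)
          - ∫ s in lo..q, interim μ i s (winProb r M.alloc i)) ∂μ := by
        refine integral_congr_ae ?_
        filter_upwards [hbox] with q hq
        rw [interimPay_eq hlo hr hbox hM hIC i hq, hG q]
    _ = _ := by
        rw [integral_sub (f := fun q => (interim μ i q fun x => grossPayoff r M.alloc i (x i) x)
            - (interimGross μ r M i lo lo - interimPay μ M i lo))
            (hGi.sub (integrable_const _)) hI,
          integral_sub hGi (integrable_const _), hE, integral_interim i hgross,
          integral_sub hgross hhaz]
        simp
        ring

end Revenue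

/-! ### Feasibility of the candidate and the sign of the virtual value -/

section Main

variable {μ : Measure ℝ} [IsProbabilityMeasure μ] {lo hi z r : ℝ} {ψ : ℝ → ℝ}
  {w : (Fin N → ℝ) → ℝ}

lemma measurable_candidateAlloc (hψ : Measurable ψ) (hw : Measurable w) (i : Fin N) :
    Measurable fun x => candidateAlloc ψ r w x i := by
  have h1 : Measurable fun x : Fin N → ℝ => orderStat 1 x := measurable_orderStat le_rfl
  have h2 : Measurable fun x : Fin N → ℝ => orderStat 2 x := measurable_orderStat one_le_two
  have r1 : Measurable fun x : Fin N → ℝ => rankShare 1 x i := measurable_rankShare le_rfl i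
  have r2 : Measurable fun x : Fin N → ℝ => rankShare 2 x i := measurable_rankShare one_le_two i
  unfold candidateAlloc
  exact Measurable.ite (measurableSet_le measurable_const (hψ.comp h1))
    (Measurable.ite (measurableSet_lt h2 measurable_const) r1
      ((hw.mul r1).add ((measurable_const.sub hw).mul r2))) measurable_const

lemma candidateAlloc_nonneg (hw : ∀ x, w x ∈ Set.Icc (0 : ℝ) 1) (x : Fin N → ℝ) (i : Fin N) :
    0 ≤ candidateAlloc ψ r w x i := by
  unfold candidateAlloc
  have h1 := rankShare_nonneg 1 x i
  have h2 := rankShare_nonneg 2 x i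
  obtain ⟨hw0, hw1⟩ := hw x
  split_ifs
  · exact h1
  · exact add_nonneg (mul_nonneg hw0 h1) (mul_nonneg (sub_nonneg.2 hw1) h2)
  · exact le_rfl

lemma sum_candidateAlloc_le (hN : 2 ≤ N) (x : Fin N → ℝ) :
    ∑ i, candidateAlloc ψ r w x i ≤ 1 := by
  unfold candidateAlloc
  split_ifs
  · exact (sum_rankShare le_rfl (one_le_two.trans hN) x).le
  · rw [Finset.sum_add_distrib, ← Finset.mul_sum, ← Finset.mul_sum,
      sum_rankShare le_rfl (one_le_two.trans hN), sum_rankShare one_le_two hN]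
    linarith
  · simp

lemma abs_orderStat_le {k : ℕ} (hk : 1 ≤ k) (hlo : 0 ≤ lo) (hhi : 0 ≤ hi) {x : Fin N → ℝ}
    (hx : ∀ j, x j ∈ Set.Icc lo hi) : |orderStat k x| ≤ hi := by
  rcases lt_or_ge N k with h | h
  · simpa [orderStat_of_lt h] using hhi
  obtain ⟨i, hi'⟩ := exists_eq_orderStat hk h x
  rw [← hi', abs_of_nonneg (hlo.trans (hx i).1)]
  exact (hx i).2

lemma isMechanism_candidate (hN : 2 ≤ N) (hlo : 0 ≤ lo) (hbox : ∀ᵐ t ∂μ, t ∈ Set.Icc lo hi)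
    (hψ : Measurable ψ) (hz : z ∈ Set.Icc 0 hi) (hr : r ∈ Set.Icc 0 hi) (hw_meas : Measurable w)
    (hw : ∀ x, w x ∈ Set.Icc (0 : ℝ) 1) :
    IsMechanism μ lo hi (candidate (N := N) ψ z r w) := by
  have hpay : ∀ i, Measurable fun x => (candidate (N := N) ψ z r w).pay x i := fun i => by
    have h2 : Measurable fun x : Fin N → ℝ => orderStat 2 x := measurable_orderStat one_le_two
    have h3 : Measurable fun x : Fin N → ℝ => orderStat 3 x := measurable_orderStat (by norm_num)
    exact (measurable_candidateAlloc hψ hw_meas i).mul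
      (Measurable.ite (measurableSet_lt h2 measurable_const) (measurable_const.max h2)
        (measurable_const.max h3))
  refine ⟨measurable_candidateAlloc hψ hw_meas, hpay, fun x _ => candidateAlloc_nonneg hw x,
    fun x _ => sum_candidateAlloc_le hN x, fun i q hq => ?_⟩
  refine integrable_update_of_bound_box (C := hi) hbox (hpay i) (fun x hx => ?_) i hq
  have hhi := hz.1.trans hz.2
  have h0 := candidateAlloc_nonneg (ψ := ψ) (r := r) hw x
  have h1 : candidateAlloc ψ r w x i ≤ 1 :=
    (Finset.single_le_sum (fun j _ => h0 j) (Finset.mem_univ i)).trans (sum_candidateAlloc_le hN x)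
  have h2 := (abs_le.1 (abs_orderStat_le one_le_two hlo hhi hx)).2
  have h3 := (abs_le.1 (abs_orderStat_le (k := 3) (by norm_num) hlo hhi hx)).2
  have hprice : ∀ p, 0 ≤ p → p ≤ hi → |candidateAlloc ψ r w x i * p| ≤ hi := fun p hp0 hp => by
    rw [abs_of_nonneg (mul_nonneg (h0 i) hp0)]
    exact (mul_le_of_le_one_left hp0 h1).trans hp
  unfold candidate
  dsimp only
  split_ifs
  · exact hprice _ (hz.1.trans (le_max_left _ _)) (max_le hz.2 h2)
  · exact hprice _ (hr.1.trans (le_max_left _ _)) (max_le hr.2 h3)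

lemma interimGross_sub_interimPay {M : DirectMechanism N} (hlo : 0 ≤ lo) (hr : 0 ≤ r)
    (hbox : ∀ᵐ t ∂μ, t ∈ Set.Icc lo hi) (hM : IsMechanism μ lo hi M) (i : Fin N) {q v : ℝ}
    (hq : q ∈ Set.Icc lo hi) (hv : v ∈ Set.Icc lo hi) :
    Integrable (fun x => netPayoff r M i v (Function.update x i q))
        (Measure.pi fun _ : Fin N => μ) ∧
      interimGross μ r M i q v - interimPay μ M i q = interim μ i q (netPayoff r M i v) := by
  have h1 := integrable_grossPayoff_update hlo hr hbox hM i hq hv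
  have h2 := hM.integrable_pay i q hq
  exact ⟨h1.sub h2, (integral_sub h1 h2).symm⟩

lemma exists_strongest_rival (hN : 2 ≤ N) (i : Fin N) (x : Fin N → ℝ) :
    ∃ c, c ≠ i ∧ ∀ j, j ≠ i → x j ≤ x c := by
  obtain ⟨c, hc, hmax⟩ := Finset.exists_max_image (Finset.univ.erase i) x (by
    rw [← Finset.card_pos, Finset.card_erase_of_mem (Finset.mem_univ _), Finset.card_univ,
      Fintype.card_fin]
    omega)
  exact ⟨c, Finset.ne_of_mem_erase hc, fun j hj => hmax j (by simp [hj])⟩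

lemma netPayoff_candidate_update (hN : 2 ≤ N)
    (hψ : ∀ t ∈ Set.Ioc lo hi, 0 ≤ ψ t ↔ z ≤ t) (hz0 : 0 ≤ z) (hzr : z ≤ r)
    (hw : ∀ x, w x ∈ Set.Icc (0 : ℝ) 1) (i : Fin N) {c : Fin N} {x : Fin N → ℝ} (hci : c ≠ i)
    (hc : ∀ j, j ≠ i → x j ≤ x c) (hinj : Function.Injective x) (hx : ∀ j, x j ∈ Set.Ioo lo hi)
    {q : ℝ} (hq : q ∈ Set.Icc lo hi) (hne : ∀ j, x j ≠ q) (v : ℝ) :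
    netPayoff r (candidate ψ z r w) i v (Function.update x i q) ≤ truthfulPayoff z r i c v x ∧
      (v = q → netPayoff r (candidate ψ z r w) i v (Function.update x i q) =
        truthfulPayoff z r i c v x) := by
  have h := netPayoff_candidate (y := Function.update x i q) hN hψ hz0 hzr hw hci
    (fun j hj => by simpa [Function.update_of_ne hj, Function.update_of_ne hci] using hc j hj)
    (injective_update hinj i hne) (by simpa using hq)
    (fun j hj => by simpa [Function.update_of_ne hj] using hx j) v
  simpa [truthfulPayoff_update z r hci] using h

lemma isFeasible_candidate [NullSingletonClass μ] (hN : 2 ≤ N) (hlo : 0 ≤ lo)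
    (hIoo : ∀ᵐ t ∂μ, t ∈ Set.Ioo lo hi)
    (hψm : Measurable ψ) (hψ : ∀ t ∈ Set.Ioc lo hi, 0 ≤ ψ t ↔ z ≤ t) (hz : lo ≤ z) (hzr : z ≤ r)
    (hrhi : r ≤ hi) (hw_meas : Measurable w) (hw : ∀ x, w x ∈ Set.Icc (0 : ℝ) 1) :
    IsFeasible μ lo hi r (candidate (N := N) ψ z r w) ∧
      ∀ i, interimGross μ r (candidate (N := N) ψ z r w) i lo lo
        - interimPay μ (candidate ψ z r w) i lo = 0 := by
  have hbox : ∀ᵐ t ∂μ, t ∈ Set.Icc lo hi := by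
    filter_upwards [hIoo] with t ht using Set.Ioo_subset_Icc_self ht
  have hz0 := hlo.trans hz
  have hr0 := hz0.trans hzr
  have hM : IsMechanism μ lo hi (candidate (N := N) ψ z r w) :=
    isMechanism_candidate hN hlo hbox hψm ⟨hz0, hzr.trans hrhi⟩ ⟨hr0, hrhi⟩ hw_meas hw
  have hae : ∀ q, ∀ᵐ x ∂(Measure.pi fun _ : Fin N => μ),
      (∀ j, x j ∈ Set.Ioo lo hi) ∧ Function.Injective x ∧ ∀ j, x j ≠ q := fun q => by
    filter_upwards [ae_forall_mem hIoo, ae_injective, ae_forall_ne q] with x h1 h2 h3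
    exact ⟨h1, h2, h3⟩
  refine ⟨⟨hM, fun i v hv q hq => ?_, fun i v hv => ?_⟩, fun i => ?_⟩
  · obtain ⟨i1, e1⟩ := interimGross_sub_interimPay hlo hr0 hbox hM i hq hv
    obtain ⟨i2, e2⟩ := interimGross_sub_interimPay hlo hr0 hbox hM i hv hv
    rw [e1, e2]
    refine integral_mono_ae i1 i2 ?_
    filter_upwards [hae q, hae v] with x ⟨hx, hinj, hnq⟩ ⟨_, _, hnv⟩
    -- The strongest rival does not depend on the own report, so one `truthfulPayoff` bounds the
    -- deviation and equals the truthful payoff.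
    obtain ⟨c, hci, hc⟩ := exists_strongest_rival hN i x
    exact (netPayoff_candidate_update hN hψ hz0 hzr hw i hci hc hinj hx hq hnq v).1.trans_eq
      ((netPayoff_candidate_update hN hψ hz0 hzr hw i hci hc hinj hx hv hnv v).2 rfl).symm
  · obtain ⟨i2, e2⟩ := interimGross_sub_interimPay hlo hr0 hbox hM i hv hv
    rw [e2]
    refine integral_mono_ae (integrable_update_of_bound_box hbox
      (measurable_secondPriceSurplus v _)
      (fun x _ => abs_secondPriceSurplus_le hr0 (hlo.trans hv.1) hv.2 _ x) i hv) i2 ?_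
    filter_upwards [hae v] with x ⟨hx, hinj, hnv⟩
    obtain ⟨c, hci, hc⟩ := exists_strongest_rival hN i x
    have h := secondPriceSurplus_le_truthfulPayoff hzr hci v (Function.update x i v)
    rw [truthfulPayoff_update z r hci] at h
    exact h.trans_eq
      ((netPayoff_candidate_update hN hψ hz0 hzr hw i hci hc hinj hx hv hnv v).2 rfl).symm
  · have hlohi : lo ∈ Set.Icc lo hi := ⟨le_rfl, hz.trans (hzr.trans hrhi)⟩
    obtain ⟨-, e⟩ := interimGross_sub_interimPay hlo hr0 hbox hM i hlohi hlohi
    rw [e]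
    refine integral_eq_zero_of_ae ?_
    filter_upwards [hae lo] with x ⟨hx, hinj, hnv⟩
    obtain ⟨c, hci, hc⟩ := exists_strongest_rival hN i x
    rw [(netPayoff_candidate_update hN hψ hz0 hzr hw i hci hc hinj hx hlohi hnv lo).2 rfl,
      truthfulPayoff_eq_zero hz hzr, Pi.zero_apply]

variable {f : ℝ → ℝ}

/-- Monotonicity settles interior points. The endpoint `hi` is needed because a deviating report may
equal it, and `z = lo` needs a limit because `ψ` is monotone only on the open interval. -/
lemma virtualValue_nonneg_iff (hlo : 0 ≤ lo) (hlohi : lo < hi)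
    (hf_cont : ContinuousOn f (Set.Icc lo hi))
    (hf_pos : ∀ x ∈ Set.Ioo lo hi, 0 < f x) (hIoo : ∀ᵐ t ∂μ, t ∈ Set.Ioo lo hi)
    (hψ : StrictMonoOn (virtualValue μ f) (Set.Ioo lo hi)) (hz_mem : z ∈ Set.Ico lo hi)
    (hz_pos : 0 < f z) (hz : virtualValue μ f z = 0) :
    ∀ t ∈ Set.Ioc lo hi, 0 ≤ virtualValue μ f t ↔ z ≤ t := by
  rintro t ⟨hlt, hth⟩
  rcases hth.eq_or_lt with rfl | hth
  -- At `hi` the numerator `1 - F` is zero, so `ψ(hi) = hi` even if `f(hi) = 0`.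
  · have : ProbabilityTheory.cdf μ t = 1 := by
      have h1 : μ (Set.Iic t) = 1 := by
        rw [← mem_ae_iff_prob_eq_one measurableSet_Iic]
        filter_upwards [hIoo] with s hs using hs.2.le
      rw [ProbabilityTheory.cdf_eq_real, measureReal_def, h1, ENNReal.toReal_one]
    rw [virtualValue, this]
    simp [hlo.trans hlohi.le, hz_mem.2.le]
  rcases hz_mem.1.eq_or_lt with rfl | hzlo
  · refine iff_of_true ?_ hlt.le
    have h0 : ProbabilityTheory.cdf μ lo = 0 := by
      rw [ProbabilityTheory.cdf_eq_real, measureReal_eq_zero_iff, ← compl_mem_ae_iff]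
      filter_upwards [hIoo] with s hs using not_le.2 hs.1
    -- Near `lo`, `ψ(s) ≥ s - 1 / f(s)`, which tends to `ψ(lo) = 0` because `f` is continuous and
    -- positive at `lo`.
    have hlim : Filter.Tendsto (fun s => s - 1 / f s) (nhdsWithin lo (Set.Ioo lo t))
        (nhds 0) := by
      have hfc : Filter.Tendsto f (nhdsWithin lo (Set.Ioo lo t)) (nhds (f lo)) :=
        (hf_cont lo ⟨le_rfl, hlohi.le⟩).mono fun s hs => ⟨hs.1.le, (hs.2.trans hth).le⟩
      have := (Filter.tendsto_id.mono_left nhdsWithin_le_nhds).sub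
        ((tendsto_const_nhds (x := (1 : ℝ))).div hfc hz_pos.ne')
      rw [virtualValue, h0, sub_zero] at hz
      rw [← hz]
      simpa using this
    have : (nhdsWithin lo (Set.Ioo lo t)).NeBot := left_nhdsWithin_Ioo_neBot hlt
    refine le_of_tendsto hlim ?_
    filter_upwards [self_mem_nhdsWithin] with s hs
    have hs' : s ∈ Set.Ioo lo hi := ⟨hs.1, hs.2.trans hth⟩
    refine le_trans ?_ (hψ hs' ⟨hlt, hth⟩ hs.2).le
    refine sub_le_sub_left (div_le_div_of_nonneg_right ?_ (hf_pos s hs').le) _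
    linarith [ProbabilityTheory.cdf_nonneg μ s]
  · rw [← hz, hψ.le_iff_le ⟨hzlo, hz_mem.2⟩ ⟨hlt, hth⟩]

end Main

end SequentialAuction
end

theorem theorem2 (N : ℕ) (hN : 2 ≤ N)
    (lo hi : ℝ) (hlo : 0 ≤ lo) (hlohi : lo < hi)
    (μ : Measure ℝ) [IsProbabilityMeasure μ]
    (f : ℝ → ℝ)
    (hf_cont : ContinuousOn f (Set.Icc lo hi))
    (hf_pos : ∀ x ∈ Set.Ioo lo hi, 0 < f x)
    (hf_zero : ∀ x, x ∉ Set.Icc lo hi → f x = 0)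
    (hμ : μ = volume.withDensity fun x => ENNReal.ofReal (f x))
    (hψ : StrictMonoOn (SequentialAuction.virtualValue μ f) (Set.Ioo lo hi))
    (z : ℝ) (hz_mem : z ∈ Set.Ico lo hi) (hz_pos : 0 < f z)
    (hz : SequentialAuction.virtualValue μ f z = 0)
    (r : ℝ) (hr : r ∈ Set.Ico z hi)
    (w : (Fin N → ℝ) → ℝ) (hw_meas : Measurable w) (hw : ∀ x, w x ∈ Set.Icc (0 : ℝ) 1) :
    SequentialAuction.IsOptimal μ lo hi r
      (SequentialAuction.candidate (SequentialAuction.virtualValue μ f) z r w) := by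
  open SequentialAuction in
  have hf := measurable_of_density hf_cont hf_zero
  have hIoo := ae_mem_Ioo hf_zero hf hμ
  have := nullSingletonClass_of_density hμ
  have hψz := virtualValue_nonneg_iff hlo hlohi hf_cont hf_pos hIoo hψ hz_mem hz_pos hz
  have hz0 := hlo.trans hz_mem.1
  have hr0 := hz0.trans hr.1
  obtain ⟨hfeas, hrent⟩ := isFeasible_candidate hN hlo hIoo
    (measurable_virtualValue hf) hψz hz_mem.1 hr.1 hr.2.le hw_meas hw
  refine ⟨hfeas, fun M hM => ?_⟩
  have hrev := fun i => integral_interimPay hlo hr0 hf_pos hf_zero hf hμ hM.isMechanism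
    hM.incentiveCompatible i
  have hrev' := fun i => integral_interimPay hlo hr0 hf_pos hf_zero hf hμ hfeas.isMechanism
    hfeas.incentiveCompatible i
  -- The outside option is an expected auction surplus, hence nonnegative.
  have hIR : ∀ i, 0 ≤ interimGross μ r M i lo lo - interimPay μ M i lo := fun i =>
    (integral_nonneg fun _ => le_max_right _ _).trans
      (hM.individuallyRational i lo ⟨le_rfl, hlohi.le⟩)
  calc revenue μ M
      ≤ ∑ i, ∫ x, virtualSurplus (virtualValue μ f) r M.alloc i x
          ∂(Measure.pi fun _ : Fin N => μ) :=
        Finset.sum_le_sum fun i _ => by rw [(hrev i).2]; linarith [hIR i]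
    _ = ∫ x, ∑ i, virtualSurplus (virtualValue μ f) r M.alloc i x
          ∂(Measure.pi fun _ : Fin N => μ) :=
        (integral_finsetSum _ fun i _ => (hrev i).1).symm
    _ ≤ ∫ x, ∑ i, virtualSurplus (virtualValue μ f) r
          (candidateAlloc (virtualValue μ f) r w) i x ∂(Measure.pi fun _ : Fin N => μ) := by
        refine integral_mono_ae (integrable_finsetSum _ fun i _ => (hrev i).1)
          (integrable_finsetSum _ fun i _ => (hrev' i).1) ?_
        filter_upwards [ae_forall_mem hIoo, ae_injective] with x hx hinj
        have hx' := fun j => Set.Ioo_subset_Icc_self (hx j)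
        exact sum_virtualSurplus_le_candidate hN hinj hx hψz hψ.monotoneOn
          (fun t ht => virtualValue_le hf_pos ht) hz0 hr.1 (hM.isMechanism.alloc_nonneg x hx')
          (hM.isMechanism.sum_alloc_le x hx') w
    _ = ∑ i, ∫ x, virtualSurplus (virtualValue μ f) r
          (candidateAlloc (virtualValue μ f) r w) i x ∂(Measure.pi fun _ : Fin N => μ) :=
        integral_finsetSum _ fun i _ => (hrev' i).1
    _ = revenue μ (candidate (virtualValue μ f) z r w) :=
        Finset.sum_congr rfl fun i _ => by rw [(hrev' i).2, hrent i, sub_zero]; rfl
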